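/- Let $(M,g)$ be a closed (compact, without boundary) connected smooth Riemannian manifold and let $L:TM\to\mathbb R$ be a Tonelli Lagrangian, i.e. a smooth function that is superlinear on every fibre and has positive definite second derivative in the fibre directions. Let $H:T^*M\to\mathbb R$, $H(q,p)=\max_{v\in T_qM}[\,p(v)-L(q,v)\,]$, be the dual Hamiltonian. Let $Q_0,Q_1\subseteq M$ be non-empty closed connected embedded submanifolds (without boundary), with conormal bundles $N^*Q_i=\{(q,p)\in T^*M : q\in Q_i,\ p|_{T_qQ_i}=0\}$, and set $$k(L;Q_0,Q_1):=\inf\{k\in\mathbb R : H^{-1}(k)\cap N^*Q_i\neq\emptyset \text{ for } i=0 \text{ and } i=1\}.$$ Let $G_i$ be the smallest normal subgroup of $\pi_1(M)$ containing the image of $\pi_1(Q_i)$, and let $\langle G_0,G_1\rangle$ be the subgroup generated by $G_0$ and $G_1$. For a normal subgroup $G$ of $\pi_1(M)$ let $M_G=\widetilde M/G$ be the associated cover ($\widetilde M$ the universal cover), let $L_G$ and $H_G$ be the lifts of $L$ and $H$ to $TM_G$ and $T^*M_G$, and define $$c(L;G):=\inf\Big\{k\in\mathbb R : T\int_0^1\big[L_G(x(s),x'(s)/T)+k\big]\,ds\ge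 0 \text{ for every closed loop } x\in H^1([0,1],M_G) \text{ and every } T>0\Big\}.$$ The Mañé critical value of the pair is $c(L;Q_0,Q_1):=c(L;\langle G_0,G_1\rangle)$. Then $$k(L;Q_0,Q_1)\le c(L;Q_0,Q_1).$$ The same bound holds for the Hamiltonian expression of the critical value, $$k(L;Q_0,Q_1)\le \inf_{u\in C^\infty(M_{\langle G_0,G_1\rangle})}\ \sup_{q\in M_{\langle G_0,G_1\rangle}} H_{\langle G_0,G_1\rangle}(q,d_qu),$$ and moreover $k(L;Q_0,Q_1)\le\max\{c(L;G_0),c(L;G_1)\}$. -/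

import Mathlib

open Set MeasureTheory Manifold Topology Bundle
open scoped ContDiff unitInterval

noncomputable section

section Lagrangian

variable {n : ℕ} {M : Type*} [TopologicalSpace M] [ChartedSpace (EuclideanSpace ℝ (Fin n)) M]

/-- `L : TM → ℝ` is a Tonelli Lagrangian on the Riemannian manifold `(M, g)`: it is smooth, its
second derivative in the fibre directions is positive definite, and it is superlinear on each
fibre. -/
structure IsTonelli [IsManifold (𝓡 n) ∞ M]
    (g : ContMDiffRiemannianMetric (𝓡 n) ∞ (EuclideanSpace ℝ (Fin n))
      (fun q : M => TangentSpace (𝓡 n) q))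
    (L : TangentBundle (𝓡 n) M → ℝ) : Prop where
  smooth : ContMDiff (𝓡 n).tangent 𝓘(ℝ, ℝ) ∞ L
  convex : ∀ (q : M) (v w : TangentSpace (𝓡 n) q), w ≠ 0 →
    0 < iteratedDeriv 2 (fun t : ℝ => L ⟨q, v + t • w⟩) 0
  superlinear : ∀ q : M, Filter.Tendsto
    (fun v : TangentSpace (𝓡 n) q => L ⟨q, v⟩ / √(g.inner q v v))
    (Filter.cocompact (TangentSpace (𝓡 n) q)) Filter.atTop

variable (n M) in
/-- The (total space of the) cotangent bundle `T*M`. -/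
abbrev CotangentBundle : Type _ :=
  TotalSpace (EuclideanSpace ℝ (Fin n) →L[ℝ] ℝ) (fun q : M => TangentSpace (𝓡 n) q →L[ℝ] ℝ)

/-- The Hamiltonian `H(q, p) = max_v (p v - L(q, v))`, the Fenchel dual of `L`. -/
def hamiltonian (L : TangentBundle (𝓡 n) M → ℝ) (ξ : CotangentBundle n M) : ℝ :=
  ⨆ v : TangentSpace (𝓡 n) ξ.proj, (ξ.snd v - L ⟨ξ.proj, v⟩)

/-- The conormal bundle `N*Q` of the submanifold `ι(Q) ⊆ M`, where `ι : Q → M` is an embedding: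
all `(q, p)` with `q ∈ Q` and `p` vanishing on `T_q Q`. -/
def conormalBundle {d : ℕ} {Q : Type*} [TopologicalSpace Q]
    [ChartedSpace (EuclideanSpace ℝ (Fin d)) Q] (ι : Q → M) : Set (CotangentBundle n M) :=
  {ξ | ∃ (x : Q) (p : TangentSpace (𝓡 n) (ι x) →L[ℝ] ℝ), ξ = ⟨ι x, p⟩ ∧
    ∀ w : TangentSpace (𝓡 d) x, p (mfderiv (𝓡 d) (𝓡 n) ι x w) = 0}

/-- The threshold `k(L; Q₀, Q₁)`: the infimum of the energies `k ∈ ℝ` such that `H⁻¹(k)` meets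
both conormal bundles `N*Q₀` and `N*Q₁`. The infimum is taken in `[-∞, ∞]`. -/
def energyThreshold {d₀ d₁ : ℕ} {Q₀ Q₁ : Type*}
    [TopologicalSpace Q₀] [ChartedSpace (EuclideanSpace ℝ (Fin d₀)) Q₀]
    [TopologicalSpace Q₁] [ChartedSpace (EuclideanSpace ℝ (Fin d₁)) Q₁]
    (L : TangentBundle (𝓡 n) M → ℝ) (ι₀ : Q₀ → M) (ι₁ : Q₁ → M) : EReal :=
  sInf ((fun k : ℝ => (k : EReal)) '' {k : ℝ |
    (hamiltonian L ⁻¹' {k} ∩ conormalBundle (d := d₀) ι₀).Nonempty ∧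
    (hamiltonian L ⁻¹' {k} ∩ conormalBundle (d := d₁) ι₁).Nonempty})

/-- The velocity `x'(s)` of a curve in `M`. -/
def velocity (x : ℝ → M) (s : ℝ) : TangentSpace (𝓡 n) (x s) :=
  mfderiv 𝓘(ℝ, ℝ) (𝓡 n) x s (1 : ℝ)

variable (n) in
/-- `x` is of class `H¹` on `[0, 1]`: it is continuous, and on every subinterval `[a, b]` that it
maps into a chart domain it is, in the chart, absolutely continuous with square-integrable
derivative. -/
def IsH1Curve (x : ℝ → M) : Prop :=
  ContinuousOn x (Icc 0 1) ∧
  ∀ (q : M) (a b : ℝ), 0 ≤ a → a ≤ b → b ≤ 1 → x '' Icc a b ⊆ (extChartAt (𝓡 n) q).source →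
    AbsolutelyContinuousOnInterval (fun s => extChartAt (𝓡 n) q (x s)) a b ∧
    MemLp (deriv (fun s => extChartAt (𝓡 n) q (x s))) 2 (volume.restrict (Icc a b))

/-- The integrand of the free-time action functional. -/
def actionIntegrand (L : TangentBundle (𝓡 n) M → ℝ) (k : ℝ) (x : ℝ → M) (T : ℝ) (s : ℝ) : ℝ :=
  L ⟨x s, T⁻¹ • velocity (n := n) x s⟩ + k

/-- The free-time action
`S_k(x, T) = T ∫₀¹ (L(x(s), x'(s)/T) + k) ds = ∫₀ᵀ (L(γ(t), γ'(t)) + k) dt`, `γ(t) = x(t/T)`. -/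
def freeTimeAction (L : TangentBundle (𝓡 n) M → ℝ) (k : ℝ) (x : ℝ → M) (T : ℝ) : ℝ :=
  T * ∫ s in (0 : ℝ)..1, actionIntegrand L k x T s

end Lagrangian

section Cover

variable {M : Type*} [TopologicalSpace M]

/-- The continuous paths `[0, 1] → M` that start at `m`, with the compact-open topology. -/
abbrev PathsFrom (m : M) : Type _ := {α : C(I, M) // α 0 = m}

/-- An element of `PathsFrom m` as a path from `m` to its endpoint. -/
def PathsFrom.toPath {m : M} (α : PathsFrom m) : Path m (α.1 1) where
  toContinuousMap := α.1
  source' := α.2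
  target' := rfl

/-- The class in `π₁(M, m)` of the loop that runs along `A` and back along `B`, where `A`, `B` are
homotopy classes of paths from `m` with the same endpoint. -/
def loopOf {m a b : M} (A : Path.Homotopic.Quotient m a) (B : Path.Homotopic.Quotient m b)
    (h : a = b) : FundamentalGroup M m :=
  FundamentalGroup.fromPath ((A.cast rfl h.symm).trans B.symm)

theorem loopOf_self {m a : M} (A : Path.Homotopic.Quotient m a) : loopOf A A rfl = 1 := by
  simp only [loopOf, Path.Homotopic.Quotient.cast_rfl_rfl,
    Path.Homotopic.Quotient.trans_symm]
  rfl

theorem loopOf_symm {m a b : M} (A : Path.Homotopic.Quotient m a)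
    (B : Path.Homotopic.Quotient m b) (h : a = b) : loopOf B A h.symm = (loopOf A B h)⁻¹ := by
  subst h
  rw [eq_inv_iff_mul_eq_one]
  simp only [loopOf, FundamentalGroup.mul_def, FundamentalGroup.one_def,
    Path.Homotopic.Quotient.cast_rfl_rfl]
  rw [Path.Homotopic.Quotient.trans_assoc, ← Path.Homotopic.Quotient.trans_assoc B.symm]
  simp

theorem loopOf_trans {m a b c : M} (A : Path.Homotopic.Quotient m a)
    (B : Path.Homotopic.Quotient m b) (C : Path.Homotopic.Quotient m c) (h : a = b) (h' : b = c) :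
    loopOf A C (h.trans h') = loopOf B C h' * loopOf A B h := by
  subst h h'
  simp only [loopOf, FundamentalGroup.mul_def, Path.Homotopic.Quotient.cast_rfl_rfl]
  rw [Path.Homotopic.Quotient.trans_assoc, ← Path.Homotopic.Quotient.trans_assoc B.symm]
  simp

/-- The class in `π₁(M, m)` of the loop that runs along `α` and back along `β`. -/
def loopClass {m : M} (α β : PathsFrom m) (h : α.1 1 = β.1 1) : FundamentalGroup M m :=
  loopOf (Path.Homotopic.Quotient.mk α.toPath) (Path.Homotopic.Quotient.mk β.toPath) h

/-- Two paths from `m` are identified if they have the same endpoint and together form a loop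
whose class lies in `G`. -/
def coverSetoid {m : M} (G : Subgroup (FundamentalGroup M m)) : Setoid (PathsFrom m) where
  r α β := ∃ h : α.1 1 = β.1 1, loopClass α β h ∈ G
  iseqv :=
    { refl := fun α => ⟨rfl, by rw [loopClass, loopOf_self]; exact G.one_mem⟩
      symm := fun {α β} ⟨h, hG⟩ => ⟨h.symm, by rw [loopClass, loopOf_symm _ _ h]; exact G.inv_mem hG⟩
      trans := fun {α β γ} ⟨h, hG⟩ ⟨h', hG'⟩ =>
        ⟨h.trans h', by rw [loopClass, loopOf_trans _ _ _ h h']; exact G.mul_mem hG' hG⟩ }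

/-- The covering space `M̃ / G` of the manifold `M` associated with a subgroup `G` of `π₁(M, m)`:
the quotient of the space of paths from `m`, with the quotient topology. For `G` trivial this is
the universal cover `M̃`. -/
abbrev CoverOf {m : M} (G : Subgroup (FundamentalGroup M m)) : Type _ :=
  Quotient (coverSetoid G)

/-- The covering projection `M̃ / G → M`, which sends the class of a path to its endpoint. -/
def coverProj {m : M} (G : Subgroup (FundamentalGroup M m)) : CoverOf G → M :=
  Quotient.lift (fun α : PathsFrom m => α.1 1) (fun _ _ ⟨h, _⟩ => h)

/-- The smallest normal subgroup of `π₁(M, m)` that contains the image of `π₁(Q)` under `ι`.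
Loops in `Q` are moved to the base point `m` along arbitrary paths `α`. -/
def normalImage {Q : Type*} [TopologicalSpace Q] (ι : Q → M) (hι : Continuous ι) (m : M) :
    Subgroup (FundamentalGroup M m) :=
  Subgroup.normalClosure {c | ∃ (x : Q) (α : Path m (ι x)) (β : Path x x),
    c = FundamentalGroup.fromPath
      (Path.Homotopic.Quotient.mk ((α.trans (β.map hι)).trans α.symm))}

end Cover

section Mane

variable {n : ℕ} {M : Type*} [TopologicalSpace M] [ChartedSpace (EuclideanSpace ℝ (Fin n)) M]
  {m : M}

variable (n) in
/-- `y` is a closed loop of class `H¹` in `M̃ / G`, parametrized on `[0, 1]`. As the covering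
projection is a local diffeomorphism, the regularity of `y` is that of its projection. -/
def IsH1LoopInCover (G : Subgroup (FundamentalGroup M m)) (y : ℝ → CoverOf G) : Prop :=
  ContinuousOn y (Icc 0 1) ∧ y 0 = y 1 ∧ IsH1Curve n (fun s => coverProj G (y s))

/-- The Mañé critical value `c(L; G) = c(L₁)` of the lift `L₁` of `L` to the cover `M₁ = M̃ / G`:
the infimum of the `k ∈ ℝ` such that every closed loop `(y, T)` in `M₁` has nonnegative action.
The `L₁`-action of a loop in `M₁` is the `L`-action of its projection. A Tonelli Lagrangian on a
compact manifold is bounded below, so the action is `+∞` where the integrand is not integrable,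
and such loops impose no condition. The infimum is taken in `[-∞, ∞]`. -/
def maneValue (L : TangentBundle (𝓡 n) M → ℝ) (G : Subgroup (FundamentalGroup M m)) : EReal :=
  sInf ((fun k : ℝ => (k : EReal)) '' {k : ℝ |
    ∀ (y : ℝ → CoverOf G) (T : ℝ), IsH1LoopInCover n G y → 0 < T →
      IntervalIntegrable (actionIntegrand L k (fun s => coverProj G (y s)) T) volume 0 1 →
      0 ≤ freeTimeAction L k (fun s => coverProj G (y s)) T})

/-- The smooth function `u` on the cover `M̃ / G` has differential `p ∈ T*_{π(z)} M` at `z`, where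
`π` is the covering projection and `T*_z (M̃ / G)` is identified with `T*_{π(z)} M`: near `z`, the
function `u` is the lift of a smooth function on `M` with differential `p`. -/
def HasSmoothGermAt (G : Subgroup (FundamentalGroup M m)) (u : CoverOf G → ℝ) (z : CoverOf G)
    (p : TangentSpace (𝓡 n) (coverProj G z) →L[ℝ] ℝ) : Prop :=
  ∃ f : M → ℝ, ContMDiff (𝓡 n) 𝓘(ℝ, ℝ) ∞ f ∧ (∀ᶠ z' in 𝓝 z, u z' = f (coverProj G z')) ∧
    ∀ v : TangentSpace (𝓡 n) (coverProj G z), p v = mfderiv (𝓡 n) 𝓘(ℝ, ℝ) f (coverProj G z) v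

/-- The Hamiltonian form `inf_u sup_z H₁(z, d_z u)` of the Mañé critical value of `M₁ = M̃ / G`,
where `u` ranges over the smooth functions on `M₁` and `H₁` is the lift of `H` to `T*M₁`. A smooth
`u` is given along with its differential `η`. -/
def maneValueHam (L : TangentBundle (𝓡 n) M → ℝ) (G : Subgroup (FundamentalGroup M m)) : EReal :=
  sInf {c : EReal | ∃ (u : CoverOf G → ℝ)
    (η : ∀ z : CoverOf G, TangentSpace (𝓡 n) (coverProj G z) →L[ℝ] ℝ),
    (∀ z, HasSmoothGermAt G u z (η z)) ∧
    c = ⨆ z : CoverOf G, ((hamiltonian L ⟨coverProj G z, η z⟩ : ℝ) : EReal)}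

end Mane

end

/-! Both submanifolds are treated separately until the last moment. Suppose `Q` lifts to the cover
and `k` is admissible in the definition of the critical value. Then some conormal covector of `Q`
has energy at most `k`. Otherwise convex duality on each tangent space
(`IsTonelli.exists_hamiltonian_le`) gives, at every point of `Q`, a vector tangent to `Q` with `L +
k < 0`. By compactness, short curves in `Q` starting anywhere lose a uniform amount of action.
Chaining them produces an orbit that recurs near some point, and closing it up there costs a bounded
amount, so a long enough chain closes to a loop in `Q` of negative action
(`exists_joinedWithAction_self_neg`). The loop stays closed in the cover because `Q` lifts
(`exists_lift_cover`), which contradicts admissibility. For the Hamiltonian form, `u` restricted to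
the lift of `Q` has a maximum, where its differential is conormal.

It remains to bring two conormal covectors to a common energy without exceeding the larger one
(`IsTonelli.exists_common_energy`). The Hamiltonian grows continuously to infinity along conormal
rays, so the lower energy can be raised. If there is no such ray, the submanifold is all of `M`, and
the intermediate value theorem is applied on the zero section instead. -/

noncomputable section

/-! ### Convex functions: separation from a subspace, and continuity of the minimum -/

section ConvexAnalysis

variable {E : Type*} [NormedAddCommGroup E] [NormedSpace ℝ E]

theorem convexOn_univ_of_iteratedDeriv_two_pos {f : E → ℝ} (hf : ContDiff ℝ 2 f)
    (h : ∀ v w : E, w ≠ 0 → 0 < iteratedDeriv 2 (fun t : ℝ => f (v + t • w)) 0) :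
    ConvexOn ℝ univ f := by
  have line : ∀ v w : E, w ≠ 0 → ConvexOn ℝ univ (fun t : ℝ => f (v + t • w)) := by
    intro v w hw
    have hφ : ContDiff ℝ 2 (fun t : ℝ => f (v + t • w)) := by fun_prop
    refine convexOn_univ_of_deriv2_nonneg (hφ.differentiable (by norm_num)) ?_ ?_
    · have := hφ.iterate_deriv' 1 1
      exact this.differentiable (by norm_num)
    · intro t
      have := h (v + t • w) w hw
      -- The hypothesis concerns time 0 only; moving the base point to `v + t • w` covers time `t`.
      have e : (fun s : ℝ => f (v + t • w + s • w)) =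
          fun s : ℝ => (fun r : ℝ => f (v + r • w)) (s + t) := by
        funext s
        congr 1
        module
      rw [e, iteratedDeriv_comp_add_const 2 (fun r : ℝ => f (v + r • w)) t] at this
      simpa [iteratedDeriv_eq_iterate] using this.le
  refine ⟨convex_univ, fun x _ y _ a b ha hb hab => ?_⟩
  rcases eq_or_ne x y with rfl | hxy
  · rw [← add_smul, ← add_smul, hab]
    simp
  · have := (line x (y - x) (sub_ne_zero.2 hxy.symm)).2 (mem_univ 0) (mem_univ 1) ha hb hab
    simp only [smul_eq_mul, mul_zero, mul_one, zero_add, zero_smul, add_zero, one_smul,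
      add_sub_cancel] at this
    convert! this using 2
    rw [show a = 1 - b by linarith]
    module

/-- A convex function that is nonnegative on a linear subspace lies above a linear form vanishing
on that subspace. -/
theorem exists_le_of_nonneg_on_submodule {f : E → ℝ} (hf : Continuous f) (hc : ConvexOn ℝ univ f)
    (W : Submodule ℝ E) (hW : ∀ w ∈ W, 0 ≤ f w) :
    ∃ p : E →L[ℝ] ℝ, (∀ w ∈ W, p w = 0) ∧ ∀ v, p v ≤ f v := by
  -- Hahn–Banach separates the open strict epigraph from `W × {0}`. The separating form vanishes on
  -- `W`, and dividing by its negative vertical component gives `p`.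
  set A : Set (E × ℝ) := {z | f z.1 < z.2}
  set B : Set (E × ℝ) := {z | z.1 ∈ W ∧ z.2 = 0}
  have hA : Convex ℝ A := by
    have := hc.convex_strict_epigraph
    simpa [A] using this
  have hAo : IsOpen A := isOpen_lt (hf.comp continuous_fst) continuous_snd
  have hB : Convex ℝ B := by
    rintro ⟨x, s⟩ ⟨hx, hs⟩ ⟨y, t⟩ ⟨hy, ht⟩ a b - - -
    exact ⟨W.add_mem (W.smul_mem _ hx) (W.smul_mem _ hy), by simp_all⟩
  have hd : Disjoint A B := by
    refine Set.disjoint_left.2 ?_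
    rintro ⟨x, s⟩ hx ⟨hxW, hs⟩
    have := hW x hxW
    simp only [A, mem_ofPred_eq] at hx hs
    linarith
  obtain ⟨F, u, hFA, hFB⟩ := geometric_hahn_banach_open hA hAo hB hd
  have hu : u ≤ 0 := by simpa using hFB 0 ⟨W.zero_mem, rfl⟩
  have split : ∀ v t, F (v, t) = F (v, 0) + t * F (0, 1) := by
    intro v t
    rw [← smul_eq_mul, ← map_smul, ← map_add]
    simp
  have hFW : ∀ w ∈ W, F (w, 0) = 0 := by
    intro w hw
    by_contra hne
    have := hFB (((u - 1) / F (w, 0)) • (w, (0 : ℝ))) ⟨W.smul_mem _ hw, by simp⟩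
    rw [map_smul, smul_eq_mul, div_mul_cancel₀ _ hne] at this
    linarith
  have hneg : F (0, 1) < 0 := by
    have h1 : (0, |f 0| + 1) ∈ A := by
      simp only [A, mem_ofPred_eq]
      linarith [le_abs_self (f 0)]
    have := hFA _ h1
    rw [split, hFW 0 W.zero_mem] at this
    have h2 : 0 < |f 0| + 1 := by positivity
    nlinarith
  have hle : ∀ v, F (v, 0) ≤ -F (0, 1) * f v := by
    intro v
    refine le_of_forall_pos_le_add fun ε hε => ?_
    have := hFA (v, f v + ε / (-F (0, 1))) (by
      simp only [A, mem_ofPred_eq]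
      have : 0 < ε / (-F (0, 1)) := div_pos hε (by linarith)
      linarith)
    rw [split, add_mul, div_mul_eq_mul_div, div_neg, mul_div_assoc, div_self hneg.ne] at this
    linarith
  refine ⟨(-F (0, 1))⁻¹ • F.comp (ContinuousLinearMap.inl ℝ E ℝ), fun w hw => ?_, fun v => ?_⟩
  · simp [hFW w hw]
  · simp only [_root_.smul_apply, ContinuousLinearMap.comp_apply,
      ContinuousLinearMap.inl_apply, smul_eq_mul]
    rw [inv_mul_le_iff₀ (by linarith)]
    exact hle v

/-- The value of `-min f` depends continuously on the convex coercive function `f`. -/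
theorem continuousAt_iSup_neg [FiniteDimensional ℝ E] {X : Type*} [TopologicalSpace X]
    {f : X → E → ℝ} {x₀ : X} (hf : ∀ v, ContinuousAt (fun z : X × E => f z.1 z.2) (x₀, v))
    (hc : ∀ᶠ x in 𝓝 x₀, ConvexOn ℝ univ (f x))
    (hlim : Filter.Tendsto (f x₀) (Filter.cocompact E) Filter.atTop) :
    ContinuousAt (fun x => ⨆ v, -f x v) x₀ := by
  have hf₀ : Continuous (f x₀) := continuous_iff_continuousAt.2 fun v =>
    ContinuousAt.comp (f := fun w : E => (x₀, w)) (hf v) (by fun_prop)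
  obtain ⟨v₀, hv₀⟩ := hf₀.exists_forall_le hlim
  -- The margin 2 absorbs two approximation errors of size at most 1.
  obtain ⟨R, hR, hball⟩ : ∃ R > 0, ∀ v, R ≤ ‖v - v₀‖ → f x₀ v₀ + 2 ≤ f x₀ v := by
    have := hlim.eventually_ge_atTop (f x₀ v₀ + 2)
    rw [← Metric.cobounded_eq_cocompact, (Metric.hasBasis_cobounded_compl_closedBall v₀).eventually_iff] at this
    obtain ⟨r, -, hr⟩ := this
    refine ⟨max r 0 + 1, by positivity, fun v hv => hr ?_⟩
    simp only [mem_compl_iff, Metric.mem_closedBall, not_le, dist_eq_norm]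
    linarith [le_max_left r 0]
  have hK : IsCompact (Metric.closedBall v₀ R) := isCompact_closedBall _ _
  have est : ∀ ε > 0, ∀ᶠ x in 𝓝 x₀, ∀ v ∈ Metric.closedBall v₀ R, |f x v - f x₀ v| < ε := by
    intro ε hε
    refine hK.eventually_forall_of_forall_eventually (P := fun x v => |f x v - f x₀ v| < ε) ?_
    intro v _
    have : ContinuousAt (fun z : X × E => |f z.1 z.2 - f x₀ z.2|) (x₀, v) :=
      ((hf v).sub (hf₀.continuousAt.comp continuousAt_snd)).abs
    exact this.eventually_lt_const (by simpa using hε)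
  have key : ∀ ε > 0, ε ≤ 1 → ∀ᶠ x in 𝓝 x₀, |(⨆ v, -f x v) - -f x₀ v₀| ≤ ε := by
    intro ε hε hε1
    filter_upwards [est ε hε, hc] with x hx hxc
    have h0 := abs_lt.1 (hx v₀ (by simp [hR.le]))
    have low : ∀ v, f x₀ v₀ - ε ≤ f x v := by
      intro v
      by_cases hv : ‖v - v₀‖ ≤ R
      · have := abs_lt.1 (hx v (by simpa [dist_eq_norm] using hv))
        linarith [hv₀ v]
      -- Coercivity is known only at `x₀`. Where the segment from `v₀` to `v` crosses the sphere of
      -- radius `R`, `f x` already exceeds `f x v₀`; convexity then gives `f x v ≥ f x v₀`.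
      · push Not at hv
        have hpos : 0 < ‖v - v₀‖ := hR.trans hv
        set s := R / ‖v - v₀‖
        have hs : 0 < s := div_pos hR hpos
        have hs1 : s ≤ 1 := (div_le_one hpos).2 hv.le
        have hn : ‖((1 - s) • v₀ + s • v) - v₀‖ = R := by
          rw [show ((1 - s) • v₀ + s • v) - v₀ = s • (v - v₀) by module, norm_smul,
            Real.norm_of_nonneg hs.le, div_mul_cancel₀ _ hpos.ne']
        have h1 := hxc.2 (mem_univ v₀) (mem_univ v) (sub_nonneg.2 hs1) hs.le (by ring)
        have h2 := abs_lt.1 (hx ((1 - s) • v₀ + s • v) (by simp [dist_eq_norm, hn]))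
        have h3 := hball _ hn.ge
        simp only [smul_eq_mul] at h1
        have h4 : 0 ≤ s * (f x v - f x v₀) := by linarith
        have := (mul_nonneg_iff_of_pos_left hs).1 h4
        linarith
    have hb : BddAbove (range fun v => -f x v) :=
      ⟨-f x₀ v₀ + ε, by rintro _ ⟨v, rfl⟩; linarith [low v]⟩
    rw [abs_le]
    constructor
    · linarith [le_ciSup hb v₀]
    · have : (⨆ v, -f x v) ≤ -f x₀ v₀ + ε := ciSup_le fun v => by linarith [low v]
      linarith
  have h₀ : (⨆ v, -f x₀ v) = -f x₀ v₀ :=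
    le_antisymm (ciSup_le fun v => neg_le_neg (hv₀ v))
      (le_ciSup (f := fun v => -f x₀ v) ⟨-f x₀ v₀, by rintro _ ⟨v, rfl⟩; exact neg_le_neg (hv₀ v)⟩ v₀)
  rw [ContinuousAt, h₀, Metric.tendsto_nhds]
  intro ε hε
  filter_upwards [key (min (ε / 2) 1) (by positivity) (min_le_right _ _)] with x hx
  rw [Real.dist_eq]
  linarith [min_le_left (ε / 2) 1]

end ConvexAnalysis

/-! ### Tonelli Lagrangian and Hamiltonian on the fibres -/

section Fibre

variable {n : ℕ} {M : Type*} [TopologicalSpace M] [ChartedSpace (EuclideanSpace ℝ (Fin n)) M]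
  [IsManifold (𝓡 n) ∞ M]

/-- The Lagrangian on the velocities of a parametrization `f` of `M` by an open set of a vector
space. -/
theorem continuousOn_lagrangian_mfderiv {L : TangentBundle (𝓡 n) M → ℝ} (hL : Continuous L)
    {E : Type*} [NormedAddCommGroup E] [NormedSpace ℝ E] {f : E → M} {U : Set E} (hU : IsOpen U)
    (hf : ContMDiffOn 𝓘(ℝ, E) (𝓡 n) ∞ f U) :
    ContinuousOn (fun z : E × E => L ⟨f z.1, mfderiv 𝓘(ℝ, E) (𝓡 n) f z.1 z.2⟩)
      (U ×ˢ univ) := by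
  have h1 := hf.continuousOn_tangentMapWithin (by simp) hU.uniqueMDiffOn
  have h2 : Continuous (fun z : E × E => (⟨z.1, z.2⟩ : TangentBundle 𝓘(ℝ, E) E)) :=
    (tangentBundleModelSpaceHomeomorph 𝓘(ℝ, E)).symm.continuous
  have h3 := hL.comp_continuousOn (h1.comp h2.continuousOn (s := U ×ˢ univ) fun z hz => hz.1)
  refine h3.congr fun z hz => ?_
  simp only [Function.comp, tangentMapWithin]
  rw [mfderivWithin_of_isOpen hU hz.1]

theorem contMDiff_totalSpaceMk (q : M) :
    ContMDiff 𝓘(ℝ, EuclideanSpace ℝ (Fin n)) (𝓡 n).tangent ∞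
      (fun v : EuclideanSpace ℝ (Fin n) => (⟨q, v⟩ : TangentBundle (𝓡 n) M)) := by
  intro v
  rw [Bundle.contMDiffAt_totalSpace]
  refine ⟨contMDiffAt_const, ?_⟩
  let A : EuclideanSpace ℝ (Fin n) →L[ℝ] EuclideanSpace ℝ (Fin n) :=
    (trivializationAt (EuclideanSpace ℝ (Fin n)) (TangentSpace (𝓡 n)) q).continuousLinearMapAt ℝ q
  refine ContDiffAt.contMDiffAt (A.contDiff.contDiffAt.congr_of_eventuallyEq
    (Filter.Eventually.of_forall fun w => ?_))
  exact ((trivializationAt (EuclideanSpace ℝ (Fin n)) (TangentSpace (𝓡 n)) q).coe_linearMapAt_of_mem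
    (R := ℝ) (mem_baseSet_trivializationAt _ _ q) ▸ rfl)

namespace IsTonelli

variable {g : ContMDiffRiemannianMetric (𝓡 n) ∞ (EuclideanSpace ℝ (Fin n))
      (fun q : M => TangentSpace (𝓡 n) q)} {L : TangentBundle (𝓡 n) M → ℝ}

theorem contDiff_fibre (hL : IsTonelli g L) (q : M) :
    ContDiff ℝ ∞ (fun v : EuclideanSpace ℝ (Fin n) => L ⟨q, v⟩) :=
  (hL.smooth.comp (contMDiff_totalSpaceMk q)).contDiff

theorem convexOn_fibre (hL : IsTonelli g L) (q : M) :
    ConvexOn ℝ univ (fun v : EuclideanSpace ℝ (Fin n) => L ⟨q, v⟩) :=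
  convexOn_univ_of_iteratedDeriv_two_pos (contDiff_infty.1 (hL.contDiff_fibre q) 2)
    (hL.convex q)

/-- The unit ball of the metric is bounded in the model norm. This converts superlinearity in the
metric into growth in the model norm. -/
theorem exists_norm_le (g : ContMDiffRiemannianMetric (𝓡 n) ∞ (EuclideanSpace ℝ (Fin n))
      (fun q : M => TangentSpace (𝓡 n) q)) (q : M) :
    ∃ C > 0, ∀ v : EuclideanSpace ℝ (Fin n), ‖v‖ ≤ C * √(g.inner q v v) := by
  have hb : Bornology.IsBounded {v : EuclideanSpace ℝ (Fin n) | g.inner q v v < 1} :=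
    (NormedSpace.isVonNBounded_iff ℝ).1 (g.isVonNBounded q)
  obtain ⟨C, hC, hCb⟩ := hb.exists_pos_norm_le
  refine ⟨2 * C, by positivity, fun v => ?_⟩
  rcases eq_or_ne v 0 with rfl | hv
  · simp; positivity
  have hpos : 0 < g.inner q v v := g.pos q v hv
  set r := √(g.inner q v v)
  have hr : 0 < r := Real.sqrt_pos.2 hpos
  have hrr : r * r = g.inner q v v := Real.mul_self_sqrt hpos.le
  have hmem : g.inner q ((2 * r)⁻¹ • v) ((2 * r)⁻¹ • v) < 1 := by
    have : g.inner q ((2 * r)⁻¹ • v) ((2 * r)⁻¹ • v) =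
        (2 * r)⁻¹ * ((2 * r)⁻¹ * g.inner q v v) := by
      erw [map_smul, map_smul]
      rfl
    rw [this, ← hrr]
    field_simp
    norm_num
  have := hCb _ hmem
  rw [norm_smul, Real.norm_of_nonneg (by positivity), inv_mul_le_iff₀ (by positivity)] at this
  linarith

theorem eventually_mul_norm_le (hL : IsTonelli g L) (q : M) (B : ℝ) :
    ∀ᶠ v : EuclideanSpace ℝ (Fin n) in Filter.cocompact (EuclideanSpace ℝ (Fin n)), B * ‖v‖ ≤ L ⟨q, v⟩ := by
  obtain ⟨C, hC, hCv⟩ := exists_norm_le g q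
  have h0 : ∀ᶠ v in Filter.cocompact (EuclideanSpace ℝ (Fin n)), v ≠ 0 :=
    (isCompact_singleton (x := (0 : EuclideanSpace ℝ (Fin n)))).compl_mem_cocompact
  have h1 : ∀ᶠ v : EuclideanSpace ℝ (Fin n) in Filter.cocompact (EuclideanSpace ℝ (Fin n)),
      |B| * C ≤ L ⟨q, v⟩ / √(g.inner q v v) :=
    (hL.superlinear q).eventually_ge_atTop (|B| * C)
  filter_upwards [h0, h1] with v hv hv1
  have hpos : 0 < √(g.inner q v v) := Real.sqrt_pos.2 (g.pos q v hv)
  replace hv1 := (le_div_iff₀ hpos).1 hv1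
  change B * ‖v‖ ≤ _
  calc B * ‖v‖ ≤ |B| * ‖v‖ := by gcongr; exact le_abs_self B
    _ ≤ |B| * (C * √(g.inner q v v)) := by gcongr; exact hCv v
    _ ≤ _ := by linarith

theorem tendsto_fibre (hL : IsTonelli g L) (q : M) :
    Filter.Tendsto (fun v : EuclideanSpace ℝ (Fin n) => L ⟨q, v⟩)
      (Filter.cocompact (EuclideanSpace ℝ (Fin n))) Filter.atTop :=
  Filter.tendsto_atTop_mono' _ ((hL.eventually_mul_norm_le q 1).mono fun v hv => by simpa using hv)
    (tendsto_norm_cocompact_atTop)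

/-- An unbounded real `⨆` would take the default value 0; superlinear growth excludes this, so
`hamiltonian` is a genuine supremum. -/
theorem bddAbove_fenchel (hL : IsTonelli g L) (q : M) (p : TangentSpace (𝓡 n) q →L[ℝ] ℝ) :
    BddAbove (range fun v : TangentSpace (𝓡 n) q => p v - L ⟨q, v⟩) := by
  let p' : EuclideanSpace ℝ (Fin n) →L[ℝ] ℝ := p
  have hc : Continuous fun v : EuclideanSpace ℝ (Fin n) => L ⟨q, v⟩ - p' v :=
    (hL.contDiff_fibre q).continuous.sub p'.continuous
  have hlim : Filter.Tendsto (fun v : EuclideanSpace ℝ (Fin n) => L ⟨q, v⟩ - p' v)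
      (Filter.cocompact (EuclideanSpace ℝ (Fin n))) Filter.atTop := by
    refine Filter.tendsto_atTop_mono' _ ?_ tendsto_norm_cocompact_atTop
    filter_upwards [hL.eventually_mul_norm_le q (1 + ‖p'‖)] with v hv
    have := (le_abs_self _).trans (p'.le_opNorm v)
    change (1 + ‖p'‖) * ‖v‖ ≤ L ⟨q, v⟩ at hv
    change ‖v‖ ≤ L ⟨q, v⟩ - p' v
    linarith
  obtain ⟨v₀, hv₀⟩ := hc.exists_forall_le hlim
  refine ⟨-(L ⟨q, v₀⟩ - p' v₀), ?_⟩
  rintro _ ⟨v, rfl⟩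
  have := hv₀ v
  change p' v - L ⟨q, v⟩ ≤ _
  linarith

theorem le_hamiltonian (hL : IsTonelli g L) (q : M) (p : TangentSpace (𝓡 n) q →L[ℝ] ℝ)
    (v : TangentSpace (𝓡 n) q) : p v - L ⟨q, v⟩ ≤ hamiltonian L ⟨q, p⟩ :=
  le_ciSup (hL.bddAbove_fenchel q p) v

/-- Along a ray in a cotangent fibre the Hamiltonian attains all values above the initial one. -/
theorem exists_hamiltonian_eq (hL : IsTonelli g L) (q : M) (p p' : TangentSpace (𝓡 n) q →L[ℝ] ℝ)
    (hp' : p' ≠ 0) {h : ℝ} (hh : hamiltonian L ⟨q, p⟩ ≤ h) :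
    ∃ t : ℝ, hamiltonian L ⟨q, p + t • p'⟩ = h := by
  obtain ⟨v, hv⟩ : ∃ v, 0 < p' v := by
    by_contra! hle
    refine hp' (ContinuousLinearMap.ext fun v => le_antisymm (hle v) ?_)
    have := hle (-v)
    rw [map_neg] at this
    change 0 ≤ p' v
    linarith
  -- A supremum of affine functions of `t` is convex, hence continuous on the open line.
  have hconv : ConvexOn ℝ univ fun t : ℝ => hamiltonian L ⟨q, p + t • p'⟩ := by
    refine ⟨convex_univ, fun s _ t _ a b ha hb hab => ?_⟩
    refine ciSup_le fun w => ?_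
    have h1 := mul_le_mul_of_nonneg_left (hL.le_hamiltonian q (p + s • p') w) ha
    have h2 := mul_le_mul_of_nonneg_left (hL.le_hamiltonian q (p + t • p') w) hb
    have e1 : ∀ r : ℝ, (p + r • p') w = p w + r * p' w := fun r => rfl
    simp only [e1, smul_eq_mul] at h1 h2 ⊢
    have e2 : p w - L ⟨q, w⟩ = (a + b) * (p w - L ⟨q, w⟩) := by rw [hab, one_mul]
    linarith
  have hcont : Continuous fun t : ℝ => hamiltonian L ⟨q, p + t • p'⟩ :=
    continuousOn_univ.1 (hconv.continuousOn isOpen_univ)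
  -- By this time the single affine function belonging to `v` has reached `h`.
  set t₁ := max 0 ((h - (p v - L ⟨q, v⟩)) / p' v)
  have ht₁ : h ≤ hamiltonian L ⟨q, p + t₁ • p'⟩ := by
    refine le_trans ?_ (hL.le_hamiltonian q (p + t₁ • p') v)
    have e1 : (p + t₁ • p') v = p v + t₁ * p' v := rfl
    have : (h - (p v - L ⟨q, v⟩)) / p' v ≤ t₁ := le_max_right _ _
    rw [div_le_iff₀ hv] at this
    linarith
  have h₀ : hamiltonian L ⟨q, p + (0 : ℝ) • p'⟩ ≤ h := by simpa using hh
  obtain ⟨t, -, ht⟩ := intermediate_value_Icc (le_max_left 0 _) hcont.continuousOn ⟨h₀, ht₁⟩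
  exact ⟨t, ht⟩

/-- If `L + k` is nonnegative on a linear subspace of a tangent space, then a covector vanishing
on the subspace has energy at most `k`. -/
theorem exists_hamiltonian_le (hL : IsTonelli g L) (q : M) (k : ℝ)
    (W : Submodule ℝ (TangentSpace (𝓡 n) q)) (hW : ∀ w ∈ W, 0 ≤ L ⟨q, w⟩ + k) :
    ∃ p : TangentSpace (𝓡 n) q →L[ℝ] ℝ, (∀ w ∈ W, p w = 0) ∧ hamiltonian L ⟨q, p⟩ ≤ k := by
  let W' : Submodule ℝ (EuclideanSpace ℝ (Fin n)) := W
  obtain ⟨p, hpW, hp⟩ := exists_le_of_nonneg_on_submodule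
    (f := fun v : EuclideanSpace ℝ (Fin n) => L ⟨q, v⟩ + k)
    ((hL.contDiff_fibre q).continuous.add continuous_const)
    ((hL.convexOn_fibre q).add_const k) W' hW
  refine ⟨p, hpW, ciSup_le fun v => ?_⟩
  have := hp v
  change p v - L ⟨q, v⟩ ≤ k
  linarith

/-- The differential of the inverse chart identifies nearby fibres with one vector space. Being
bijective, it preserves the supremum and the coercivity, so `continuousAt_iSup_neg` applies. -/
theorem continuous_hamiltonian_zero (hL : IsTonelli g L) :
    Continuous fun q : M => hamiltonian L ⟨q, 0⟩ := by
  refine continuous_iff_continuousAt.2 fun q₀ => ?_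
  set φ := extChartAt (𝓡 n) q₀
  have hU : IsOpen φ.target := isOpen_extChartAt_target q₀
  have hf : ContMDiffOn 𝓘(ℝ, EuclideanSpace ℝ (Fin n)) (𝓡 n) ∞ φ.symm φ.target :=
    contMDiffOn_extChartAt_symm q₀
  have hF := continuousOn_lagrangian_mfderiv hL.smooth.continuous hU hf
  have hsurj : ∀ w ∈ φ.target, Function.Bijective
      (mfderiv 𝓘(ℝ, EuclideanSpace ℝ (Fin n)) (𝓡 n) φ.symm w) := by
    intro w hw
    have h := isInvertible_mfderivWithin_extChartAt_symm
      (show w ∈ (extChartAt (𝓡 n) q₀).target from hw)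
    rw [ModelWithCorners.range_eq_univ, mfderivWithin_univ] at h
    exact h.bijective
  have hw₀ : φ q₀ ∈ φ.target := mem_extChartAt_target q₀
  have key : ContinuousAt (fun w => ⨆ v : EuclideanSpace ℝ (Fin n),
      -L ⟨φ.symm w, mfderiv 𝓘(ℝ, EuclideanSpace ℝ (Fin n)) (𝓡 n) φ.symm w v⟩) (φ q₀) := by
    refine continuousAt_iSup_neg (fun v => ?_) ?_ ?_
    · exact hF.continuousAt ((hU.prod isOpen_univ).mem_nhds ⟨hw₀, mem_univ _⟩)
    · filter_upwards [hU.mem_nhds hw₀] with w hw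
      let A : EuclideanSpace ℝ (Fin n) →ₗ[ℝ] EuclideanSpace ℝ (Fin n) :=
        (mfderiv 𝓘(ℝ, EuclideanSpace ℝ (Fin n)) (𝓡 n) φ.symm w).toLinearMap
      exact (hL.convexOn_fibre (φ.symm w)).comp_linearMap A
    · let A : EuclideanSpace ℝ (Fin n) →ₗ[ℝ] EuclideanSpace ℝ (Fin n) :=
        (mfderiv 𝓘(ℝ, EuclideanSpace ℝ (Fin n)) (𝓡 n) φ.symm (φ q₀)).toLinearMap
      have hA : Function.Injective A := (hsurj _ hw₀).1
      exact (hL.tendsto_fibre (φ.symm (φ q₀))).comp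
        (LinearMap.isClosedEmbedding_of_injective (LinearMap.ker_eq_bot.2 hA)).tendsto_cocompact
  have key2 := ContinuousAt.comp_of_eq (f := φ) key (continuousAt_extChartAt q₀) rfl
  refine key2.congr ?_
  filter_upwards [show φ.source ∈ 𝓝 q₀ from extChartAt_source_mem_nhds q₀] with q hq
  have hb := hsurj (φ q) (φ.map_source hq)
  rw [Function.comp_apply]
  have := hb.2.iSup_comp (fun v : TangentSpace (𝓡 n) (φ.symm (φ q)) =>
    (-L ⟨φ.symm (φ q), v⟩ : ℝ))
  refine Eq.trans this ?_
  rw [φ.left_inv hq]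
  simp [hamiltonian]

end IsTonelli

end Fibre

/-! ### Conormal covectors and matching of energies -/

section Conormal

variable {n : ℕ} {M : Type*} [TopologicalSpace M] [ChartedSpace (EuclideanSpace ℝ (Fin n)) M]

/-- An immersion forces `d ≤ n`, so for `d ≠ n` the range of the differential is a proper subspace
and some nonzero form kills it. -/
theorem exists_conormal_ne_zero {d : ℕ} {Q : Type*} [TopologicalSpace Q]
    [ChartedSpace (EuclideanSpace ℝ (Fin d)) Q] {ι : Q → M}
    (hι : IsImmersion (𝓡 d) (𝓡 n) ∞ ι) (hd : d ≠ n) (x : Q) :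
    ∃ p : TangentSpace (𝓡 n) (ι x) →L[ℝ] ℝ, p ≠ 0 ∧
      ∀ w : TangentSpace (𝓡 d) x, p (mfderiv (𝓡 d) (𝓡 n) ι x w) = 0 := by
  have e := (hι.isImmersionAt x).equiv
  have hinj : Function.Injective
      (e.toLinearMap ∘ₗ LinearMap.inl ℝ (EuclideanSpace ℝ (Fin d)) (hι.isImmersionAt x).complement) :=
    e.injective.comp LinearMap.inl_injective
  have hle := LinearMap.finrank_le_finrank_of_injective hinj
  simp only [finrank_euclideanSpace, Fintype.card_fin] at hle
  let A : EuclideanSpace ℝ (Fin d) →ₗ[ℝ] EuclideanSpace ℝ (Fin n) :=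
    (mfderiv (𝓡 d) (𝓡 n) ι x).toLinearMap
  have hlt : A.range < ⊤ := by
    refine lt_top_iff_ne_top.2 fun h => ?_
    have h1 := A.finrank_range_le
    rw [h, finrank_top] at h1
    simp only [finrank_euclideanSpace, Fintype.card_fin] at h1
    omega
  obtain ⟨f, hf, hfA⟩ := Submodule.exists_le_ker_of_lt_top _ hlt
  let p : EuclideanSpace ℝ (Fin n) →L[ℝ] ℝ := LinearMap.toContinuousLinearMap f
  refine ⟨p, fun h => hf ?_, fun w => hfA ⟨w, rfl⟩⟩
  exact LinearMap.ext fun v => DFunLike.congr_fun h v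

/-- In adapted charts `ι` is an injective linear endomorphism, hence an isomorphism and open. -/
theorem isOpen_range_of_isImmersion {Q : Type*} [TopologicalSpace Q]
    [ChartedSpace (EuclideanSpace ℝ (Fin n)) Q] {ι : Q → M}
    (hι : IsImmersion (𝓡 n) (𝓡 n) ∞ ι) : IsOpen (range ι) := by
  rw [isOpen_iff_mem_nhds]
  rintro _ ⟨x, rfl⟩
  have h := hι.isImmersionAt x
  set φ := h.domChart.extend (𝓡 n)
  set ψ := h.codChart.extend (𝓡 n)
  have hinj : Function.Injective
      (h.equiv.toLinearMap ∘ₗ LinearMap.inl ℝ (EuclideanSpace ℝ (Fin n)) h.complement) :=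
    h.equiv.injective.comp LinearMap.inl_injective
  let A : EuclideanSpace ℝ (Fin n) ≃ₗ[ℝ] EuclideanSpace ℝ (Fin n) :=
    LinearEquiv.ofInjectiveEndo _ hinj
  have hA : ∀ u, A u = h.equiv (u, 0) := fun u => rfl
  have hAT : IsOpen (A '' φ.target) :=
    A.toContinuousLinearEquiv.toHomeomorph.isOpenMap _ (h.domChart.isOpen_extend_target)
  have hxφ : x ∈ φ.source := by
    rw [OpenPartialHomeomorph.extend_source]
    exact h.mem_domChart_source
  have hxψ : ι x ∈ ψ.source := by
    rw [OpenPartialHomeomorph.extend_source]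
    exact h.mem_codChart_source
  have hmaps : ∀ u ∈ φ.target, ι (φ.symm u) ∈ ψ.source ∧ ψ (ι (φ.symm u)) = A u := by
    intro u hu
    refine ⟨?_, h.writtenInCharts hu⟩
    have h1 := φ.map_target hu
    rw [OpenPartialHomeomorph.extend_source] at h1 ⊢
    exact h.source_subset_preimage_source h1
  have hcont : ContinuousAt ψ (ι x) := h.codChart.continuousAt_extend h.mem_codChart_source
  have hmem : ψ (ι x) ∈ A '' φ.target := by
    have := (hmaps (φ x) (φ.map_source hxφ)).2
    rw [φ.left_inv hxφ] at this
    exact ⟨φ x, φ.map_source hxφ, this.symm⟩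
  filter_upwards [hcont (hAT.mem_nhds hmem),
    show ψ.source ∈ 𝓝 (ι x) from h.codChart.extend_source_mem_nhds h.mem_codChart_source]
    with y hy hys
  obtain ⟨u, hu, huy⟩ := hy
  obtain ⟨h1, h2⟩ := hmaps u hu
  exact ⟨φ.symm u, ψ.injOn h1 hys (h2.trans huy)⟩

variable [IsManifold (𝓡 n) ∞ M]
  {g : ContMDiffRiemannianMetric (𝓡 n) ∞ (EuclideanSpace ℝ (Fin n))
      (fun q : M => TangentSpace (𝓡 n) q)} {L : TangentBundle (𝓡 n) M → ℝ}

/-- A nonzero conormal covector at `x` gives a ray along which the lower energy rises to the higher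
one. Without one, `d₀ = n`, so the image of `Q₀` is open and closed, hence all of `M`, and the whole
zero section is conormal to it. -/
theorem IsTonelli.exists_common_energy [T2Space M] [ConnectedSpace M] (hL : IsTonelli g L)
    {d₀ d₁ : ℕ} {Q₀ Q₁ : Type*}
    [TopologicalSpace Q₀] [ChartedSpace (EuclideanSpace ℝ (Fin d₀)) Q₀] [CompactSpace Q₀]
    [TopologicalSpace Q₁] [ChartedSpace (EuclideanSpace ℝ (Fin d₁)) Q₁]
    {ι₀ : Q₀ → M} (hι₀ : IsImmersion (𝓡 d₀) (𝓡 n) ∞ ι₀) {ι₁ : Q₁ → M}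
    {ξ₀ ξ₁ : CotangentBundle n M} (h₀ : ξ₀ ∈ conormalBundle (d := d₀) ι₀)
    (h₁ : ξ₁ ∈ conormalBundle (d := d₁) ι₁) (hle : hamiltonian L ξ₀ ≤ hamiltonian L ξ₁) :
    ∃ k ≤ hamiltonian L ξ₁, (hamiltonian L ⁻¹' {k} ∩ conormalBundle (d := d₀) ι₀).Nonempty ∧
      (hamiltonian L ⁻¹' {k} ∩ conormalBundle (d := d₁) ι₁).Nonempty := by
  obtain ⟨x, p, rfl, hp⟩ := h₀
  by_cases hex : ∃ p' : TangentSpace (𝓡 n) (ι₀ x) →L[ℝ] ℝ, p' ≠ 0 ∧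
      ∀ w : TangentSpace (𝓡 d₀) x, p' (mfderiv (𝓡 d₀) (𝓡 n) ι₀ x w) = 0
  · obtain ⟨p', hp', hann⟩ := hex
    obtain ⟨t, ht⟩ := hL.exists_hamiltonian_eq (ι₀ x) p p' hp' hle
    refine ⟨_, le_rfl, ⟨_, ht, x, p + t • p', rfl, fun w => ?_⟩, ⟨ξ₁, rfl, h₁⟩⟩
    have : (p + t • p') (mfderiv (𝓡 d₀) (𝓡 n) ι₀ x w) =
      p (mfderiv (𝓡 d₀) (𝓡 n) ι₀ x w) + t * p' (mfderiv (𝓡 d₀) (𝓡 n) ι₀ x w) := rfl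
    rw [this, hp, hann, mul_zero, add_zero]
  obtain rfl : d₀ = n := by
    by_contra hd
    exact hex (exists_conormal_ne_zero hι₀ hd x)
  have hp0 : p = 0 := by
    by_contra hne
    exact hex ⟨p, hne, hp⟩
  subst hp0
  have hsurj : ∀ q, q ∈ range ι₀ := by
    have hcl : IsClopen (range ι₀) :=
      ⟨(isCompact_range hι₀.contMDiff.continuous).isClosed, isOpen_range_of_isImmersion hι₀⟩
    have := hcl.eq_univ ⟨_, mem_range_self x⟩
    intro q
    rw [this]
    trivial
  have hzero : ∀ q, (⟨q, 0⟩ : CotangentBundle d₀ M) ∈ conormalBundle (d := d₀) ι₀ := by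
    intro q
    obtain ⟨y, rfl⟩ := hsurj q
    exact ⟨y, 0, rfl, fun w => rfl⟩
  obtain ⟨y, p₁, rfl, hp₁⟩ := h₁
  -- Either the zero covector at `ι₁ y` serves both submanifolds, or the energy of the zero section
  -- crosses that of `p₁` between `ι₀ x` and `ι₁ y`.
  rcases le_total (hamiltonian L ⟨ι₁ y, 0⟩) (hamiltonian L ⟨ι₁ y, p₁⟩) with hlt | hge
  · exact ⟨_, hlt, ⟨⟨ι₁ y, 0⟩, rfl, hzero _⟩, ⟨⟨ι₁ y, 0⟩, rfl, y, 0, rfl, fun w => rfl⟩⟩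
  · obtain ⟨q, hq⟩ := intermediate_value_univ (ι₀ x) (ι₁ y) hL.continuous_hamiltonian_zero
      ⟨hle, hge⟩
    exact ⟨_, le_rfl, ⟨⟨q, 0⟩, hq, hzero q⟩, ⟨⟨ι₁ y, p₁⟩, rfl, y, p₁, rfl, hp₁⟩⟩

theorem IsTonelli.energyThreshold_le [T2Space M] [ConnectedSpace M] (hL : IsTonelli g L)
    {d₀ d₁ : ℕ} {Q₀ Q₁ : Type*}
    [TopologicalSpace Q₀] [ChartedSpace (EuclideanSpace ℝ (Fin d₀)) Q₀] [CompactSpace Q₀]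
    [TopologicalSpace Q₁] [ChartedSpace (EuclideanSpace ℝ (Fin d₁)) Q₁] [CompactSpace Q₁]
    {ι₀ : Q₀ → M} (hι₀ : IsImmersion (𝓡 d₀) (𝓡 n) ∞ ι₀) {ι₁ : Q₁ → M}
    (hι₁ : IsImmersion (𝓡 d₁) (𝓡 n) ∞ ι₁)
    {ξ₀ ξ₁ : CotangentBundle n M} (h₀ : ξ₀ ∈ conormalBundle (d := d₀) ι₀)
    (h₁ : ξ₁ ∈ conormalBundle (d := d₁) ι₁) {k : EReal} (hk₀ : (hamiltonian L ξ₀ : EReal) ≤ k)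
    (hk₁ : (hamiltonian L ξ₁ : EReal) ≤ k) :
    energyThreshold (d₀ := d₀) (d₁ := d₁) L ι₀ ι₁ ≤ k := by
  rcases le_total (hamiltonian L ξ₀) (hamiltonian L ξ₁) with hle | hle
  · obtain ⟨e, he, hn⟩ := hL.exists_common_energy hι₀ h₀ h₁ hle
    exact (show energyThreshold L ι₀ ι₁ ≤ (e : EReal) from sInf_le ⟨e, hn, rfl⟩).trans ((EReal.coe_le_coe_iff.2 he).trans hk₁)
  · obtain ⟨e, he, hn⟩ := hL.exists_common_energy hι₁ h₁ h₀ hle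
    exact (show energyThreshold L ι₀ ι₁ ≤ (e : EReal) from sInf_le ⟨e, hn.symm, rfl⟩).trans ((EReal.coe_le_coe_iff.2 he).trans hk₀)

end Conormal

/-! ### Lifting a submanifold to the cover -/

section Lift

variable {M : Type*} [TopologicalSpace M] {m : M}

/-- A path from `m` as an element of `PathsFrom m`. -/
def PathsFrom.ofPath {q : M} (γ : Path m q) : PathsFrom m := ⟨γ.toContinuousMap, γ.source⟩

theorem loopOf_cast {a b q : M} (γ γ' : Path m q) (ha : a = q) (hb : b = q) (h : a = b) :
    loopOf (Path.Homotopic.Quotient.mk (γ.cast rfl ha))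
      (Path.Homotopic.Quotient.mk (γ'.cast rfl hb)) h =
    FundamentalGroup.fromPath (Path.Homotopic.Quotient.mk (γ.trans γ'.symm)) := by
  subst ha hb
  rfl

theorem loopClass_ofPath {q : M} (γ γ' : Path m q)
    (h : (PathsFrom.ofPath γ).1 1 = (PathsFrom.ofPath γ').1 1) :
    loopClass (PathsFrom.ofPath γ) (PathsFrom.ofPath γ') h =
      FundamentalGroup.fromPath (Path.Homotopic.Quotient.mk (γ.trans γ'.symm)) :=
  loopOf_cast γ γ' γ.target γ'.target h

/-- The point of the cover represented by a path. -/
def coverMk {q : M} (G : Subgroup (FundamentalGroup M m)) (γ : Path m q) : CoverOf G :=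
  Quotient.mk (coverSetoid G) (PathsFrom.ofPath γ)

theorem coverProj_coverMk {q : M} (G : Subgroup (FundamentalGroup M m)) (γ : Path m q) :
    coverProj G (coverMk G γ) = q := γ.target

/-- The two paths differ by a loop of `Q` conjugated by `α`, which is one of the generators of
`normalImage`. -/
theorem coverMk_eq_of_normalImage_le {Q : Type*} [TopologicalSpace Q] {ι : Q → M}
    (hι : Continuous ι) {G : Subgroup (FundamentalGroup M m)} (hG : normalImage ι hι m ≤ G)
    {x y : Q} (α : Path m (ι x)) (β β' : Path x y) :
    coverMk G (α.trans (β.map hι)) = coverMk G (α.trans (β'.map hι)) := by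
  have hend : (PathsFrom.ofPath (α.trans (β.map hι))).1 1 =
      (PathsFrom.ofPath (α.trans (β'.map hι))).1 1 :=
    (α.trans (β.map hι)).target.trans (α.trans (β'.map hι)).target.symm
  refine Quotient.sound (s := coverSetoid G) ⟨hend, ?_⟩
  rw [loopClass_ofPath]
  refine hG (Subgroup.subset_normalClosure ⟨x, α, β.trans β'.symm, ?_⟩)
  congr 1
  simp only [Path.trans_symm, Path.map_trans, Path.map_symm, Path.Homotopic.Quotient.mk_trans,
    Path.Homotopic.Quotient.trans_assoc]

/-- Straight lines in a chart provide a continuous family of paths from a given point. -/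
theorem exists_continuous_family_path {d : ℕ} {Q : Type*} [TopologicalSpace Q]
    [ChartedSpace (EuclideanSpace ℝ (Fin d)) Q] (x : Q) :
    ∃ V ∈ 𝓝 x, ∃ γ : ∀ y : V, Path x (y : Q), Continuous ↿γ := by
  set φ := extChartAt (𝓡 d) x
  have hU : IsOpen φ.target := isOpen_extChartAt_target x
  obtain ⟨r, hr, hball⟩ := Metric.isOpen_iff.1 hU (φ x) (mem_extChartAt_target x)
  have hV : φ.source ∩ φ ⁻¹' Metric.ball (φ x) r ∈ 𝓝 x :=
    Filter.inter_mem (extChartAt_source_mem_nhds x)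
      (continuousAt_extChartAt x (Metric.ball_mem_nhds _ hr))
  set V := φ.source ∩ φ ⁻¹' Metric.ball (φ x) r
  have hcV : Continuous fun y : V => φ y :=
    continuousOn_iff_continuous_domRestrict.1 ((continuousOn_extChartAt x).mono inter_subset_left)
  have hline : Continuous fun z : V × I => φ x + (z.2 : ℝ) • (φ z.1 - φ x) :=
    continuous_const.add ((continuous_subtype_val.comp continuous_snd).smul
      ((hcV.comp continuous_fst).sub continuous_const))
  have hmem : ∀ z : V × I, φ x + (z.2 : ℝ) • (φ z.1 - φ x) ∈ φ.target := by
    intro z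
    refine hball ?_
    have := (convex_ball (φ x) r).add_smul_sub_mem (Metric.mem_ball_self hr) z.1.2.2 z.2.2
    exact this
  have hcont : Continuous fun z : V × I => φ.symm (φ x + (z.2 : ℝ) • (φ z.1 - φ x)) :=
    (continuousOn_extChartAt_symm x).comp_continuous hline hmem
  refine ⟨V, hV, fun y => ⟨⟨fun t => φ.symm (φ x + (t : ℝ) • (φ y - φ x)), ?_⟩, ?_, ?_⟩, hcont⟩
  · exact hcont.comp (by fun_prop : Continuous fun t : I => (y, t))
  · simp [φ]
  · simpa using φ.left_inv y.2.1

/-- If the image of `π₁(Q)` is contained in `G`, then `ι : Q → M` lifts to the cover `M̃ / G`. -/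
theorem exists_lift_cover [PathConnectedSpace M] {d : ℕ} {Q : Type*} [TopologicalSpace Q]
    [ChartedSpace (EuclideanSpace ℝ (Fin d)) Q] [PathConnectedSpace Q] {ι : Q → M}
    (hι : Continuous ι) {G : Subgroup (FundamentalGroup M m)} (hG : normalImage ι hι m ≤ G) :
    ∃ s : Q → CoverOf G, Continuous s ∧ ∀ x, coverProj G (s x) = ι x := by
  obtain ⟨x₀⟩ : Nonempty Q := inferInstance
  let α : Path m (ι x₀) := PathConnectedSpace.somePath _ _
  let β : ∀ x, Path x₀ x := fun x => PathConnectedSpace.somePath _ _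
  refine ⟨fun x => coverMk G (α.trans ((β x).map hι)), ?_, fun x => coverProj_coverMk G _⟩
  refine continuous_iff_continuousAt.2 fun x => ?_
  -- The chosen paths `β y` need not vary continuously. Near `x` they may be replaced by `β x`
  -- followed by `γ y`, which represents the same point of the cover and does.
  obtain ⟨V, hV, γ, hγ⟩ := exists_continuous_family_path (d := d) x
  refine ContinuousOn.continuousAt (s := V) ?_ hV
  rw [continuousOn_iff_continuous_domRestrict]
  have h1 : Continuous ↿fun y : V => (β x).trans (γ y) :=
    Path.trans_continuous_family _ ((β x).continuous.comp continuous_snd) _ hγ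
  have h2 : Continuous ↿fun y : V => α.trans (((β x).trans (γ y)).map hι) :=
    Path.trans_continuous_family _ (α.continuous.comp continuous_snd) _ (hι.comp h1)
  let F : C(V × I, M) := ⟨_, h2⟩
  have h3 : Continuous fun y : V =>
      PathsFrom.ofPath (α.trans (((β x).trans (γ y)).map hι)) :=
    (ContinuousMap.curry F).continuous.subtype_mk _
  have h4 : Continuous fun y : V => coverMk G (α.trans (((β x).trans (γ y)).map hι)) :=
    continuous_quotient_mk'.comp h3
  exact h4.congr fun y => coverMk_eq_of_normalImage_le hι hG α _ _

end Lift

/-! ### Maxima of functions on the cover along a lifted submanifold -/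

section HamiltonianForm

/-- Where `f` is not differentiable, `mfderiv` is zero by default. -/
theorem mfderiv_eq_zero_of_isLocalMax {d : ℕ} {Q : Type*} [TopologicalSpace Q]
    [ChartedSpace (EuclideanSpace ℝ (Fin d)) Q] {f : Q → ℝ} {x : Q} (h : IsLocalMax f x) :
    mfderiv (𝓡 d) 𝓘(ℝ, ℝ) f x = 0 := by
  by_cases hf : MDifferentiableAt (𝓡 d) 𝓘(ℝ, ℝ) f x
  · rw [hf.mfderiv, ModelWithCorners.range_eq_univ, fderivWithin_univ]
    refine IsLocalMax.fderiv_eq_zero ?_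
    have hs : extChartAt (𝓡 d) x x ∈ (extChartAt (𝓡 d) x).target := mem_extChartAt_target x
    have hc : ContinuousAt (extChartAt (𝓡 d) x).symm (extChartAt (𝓡 d) x x) :=
      (continuousOn_extChartAt_symm x).continuousAt ((isOpen_extChartAt_target x).mem_nhds hs)
    have h' : ∀ᶠ y in 𝓝 ((extChartAt (𝓡 d) x).symm (extChartAt (𝓡 d) x x)), f y ≤ f x := by
      rw [extChartAt_to_inv]
      exact h
    filter_upwards [hc h'] with w hw
    change f _ ≤ f _
    rw [extChartAt_to_inv]
    exact hw
  · exact mfderiv_zero_of_not_mdifferentiableAt hf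

variable {n : ℕ} {M : Type*} [TopologicalSpace M] [ChartedSpace (EuclideanSpace ℝ (Fin n)) M]
  {m : M}

/-- The differential of a smooth function on the cover is conormal to a compact submanifold that
lifts to the cover at a maximum point of the function on the lift. -/
theorem exists_conormal_of_hasSmoothGermAt {d : ℕ} {Q : Type*} [TopologicalSpace Q]
    [ChartedSpace (EuclideanSpace ℝ (Fin d)) Q] [CompactSpace Q] [Nonempty Q] {ι : Q → M}
    (hι : ContMDiff (𝓡 d) (𝓡 n) ∞ ι) {G : Subgroup (FundamentalGroup M m)} {s : Q → CoverOf G}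
    (hs : Continuous s) (hsι : ∀ x, coverProj G (s x) = ι x) {u : CoverOf G → ℝ}
    {η : ∀ z : CoverOf G, TangentSpace (𝓡 n) (coverProj G z) →L[ℝ] ℝ}
    (hu : ∀ z, HasSmoothGermAt G u z (η z)) :
    ∃ z, (⟨coverProj G z, η z⟩ : CotangentBundle n M) ∈ conormalBundle (d := d) ι := by
  have hcu : Continuous (u ∘ s) := by
    refine continuous_iff_continuousAt.2 fun x => ?_
    obtain ⟨f, hf, hfu, -⟩ := hu (s x)
    refine (hf.continuous.comp hι.continuous).continuousAt.congr ?_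
    filter_upwards [hs.continuousAt.eventually hfu] with y hy
    simp [hy, hsι]
  obtain ⟨x, -, hx⟩ := isCompact_univ.exists_isMaxOn univ_nonempty hcu.continuousOn
  refine ⟨s x, ?_⟩
  obtain ⟨f, hf, hfu, hη⟩ := hu (s x)
  let df : ∀ q : M, TangentSpace (𝓡 n) q →L[ℝ] ℝ := fun q => mfderiv (𝓡 n) 𝓘(ℝ, ℝ) f q
  have e : (⟨coverProj G (s x), η (s x)⟩ : CotangentBundle n M) = ⟨ι x, df (ι x)⟩ := by
    rw [show η (s x) = df (coverProj G (s x)) from ContinuousLinearMap.ext hη, hsι]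
  refine ⟨x, df (ι x), e, fun w => ?_⟩
  have hmax : IsLocalMax (f ∘ ι) x := by
    filter_upwards [hs.continuousAt.eventually hfu] with y hy
    have h1 : u (s y) ≤ u (s x) := hx (mem_univ y)
    rw [hy, hfu.self_of_nhds, hsι, hsι] at h1
    exact h1
  have h2 := mfderiv_eq_zero_of_isLocalMax (d := d) hmax
  rw [mfderiv_comp x (hf.mdifferentiable (by simp) _) (hι.mdifferentiable (by simp) x)] at h2
  exact DFunLike.congr_fun h2 w

end HamiltonianForm

/-! ### Curves, reparametrization and concatenation -/

section Curves

variable {n : ℕ} {M : Type*} [TopologicalSpace M] [ChartedSpace (EuclideanSpace ℝ (Fin n)) M]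

variable (n) in
/-- The curve `x` is Lipschitz in the charts of `M` on the interval `[c, d]`. -/
def LipschitzInCharts (x : ℝ → M) (c d : ℝ) : Prop :=
  ∀ (q : M) (a b : ℝ), c ≤ a → a ≤ b → b ≤ d → x '' Icc a b ⊆ (extChartAt (𝓡 n) q).source →
    ∃ K, LipschitzOnWith K (fun s => extChartAt (𝓡 n) q (x s)) (Icc a b)

theorem LipschitzOnWith.Icc_union {X : Type*} [PseudoMetricSpace X] {f : ℝ → X} {a b e : ℝ}
    {K K' : NNReal} (hab : LipschitzOnWith K f (Icc a e)) (hbc : LipschitzOnWith K' f (Icc e b)) :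
    LipschitzOnWith (max K K') f (Icc a b) := by
  have h₁ := hab.weaken (le_max_left K K')
  have h₂ := hbc.weaken (le_max_right K K')
  set C := max K K'
  have main : ∀ s ∈ Icc a b, ∀ t ∈ Icc a b, s ≤ t → dist (f s) (f t) ≤ C * dist s t := by
    intro s hs t ht hst
    rcases le_total t e with hte | het
    · exact h₁.dist_le_mul s ⟨hs.1, hst.trans hte⟩ t ⟨ht.1, hte⟩
    rcases le_total e s with hes | hse
    · exact h₂.dist_le_mul s ⟨hes, hs.2⟩ t ⟨het, ht.2⟩
    calc dist (f s) (f t) ≤ dist (f s) (f e) + dist (f e) (f t) := dist_triangle _ _ _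
      _ ≤ C * dist s e + C * dist e t :=
        add_le_add (h₁.dist_le_mul s ⟨hs.1, hse⟩ e ⟨hs.1.trans hse, le_rfl⟩)
          (h₂.dist_le_mul e ⟨le_rfl, het.trans ht.2⟩ t ⟨het, ht.2⟩)
      _ = C * dist s t := by
        rw [Real.dist_eq, Real.dist_eq, Real.dist_eq, abs_of_nonpos (by linarith),
          abs_of_nonpos (by linarith), abs_of_nonpos (by linarith)]
        ring
  refine LipschitzOnWith.of_dist_le_mul fun s hs t ht => ?_
  rcases le_total s t with h | h
  · exact main s hs t ht h
  · rw [dist_comm, dist_comm s]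
    exact main t ht s hs h

namespace LipschitzInCharts

variable {x x' : ℝ → M} {c d e : ℝ}

theorem union (h₁ : LipschitzInCharts n x c e) (h₂ : LipschitzInCharts n x e d) :
    LipschitzInCharts n x c d := by
  intro q a b hca hab hbd hsub
  rcases le_total b e with hbe | heb
  · exact h₁ q a b hca hab hbe hsub
  rcases le_total e a with hea | hae
  · exact h₂ q a b hea hab hbd hsub
  obtain ⟨K, hK⟩ := h₁ q a e hca hae le_rfl ((image_mono (Icc_subset_Icc_right heb)).trans hsub)
  obtain ⟨K', hK'⟩ := h₂ q e b le_rfl heb hbd ((image_mono (Icc_subset_Icc_left hae)).trans hsub)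
  exact ⟨_, hK.Icc_union hK'⟩

theorem congr (h : LipschitzInCharts n x c d) (hx : EqOn x' x (Icc c d)) :
    LipschitzInCharts n x' c d := by
  intro q a b hca hab hbd hsub
  have hx' : EqOn x' x (Icc a b) := hx.mono (Icc_subset_Icc hca hbd)
  rw [image_congr hx'] at hsub
  obtain ⟨K, hK⟩ := h q a b hca hab hbd hsub
  refine ⟨K, fun s hs t ht => ?_⟩
  simpa only [hx' hs, hx' ht] using hK hs ht

theorem comp_affine {r β : ℝ} (hr : 0 < r) (h : LipschitzInCharts n x (r * c + β) (r * d + β)) :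
    LipschitzInCharts n (fun t => x (r * t + β)) c d := by
  intro q a b hca hab hbd hsub
  have hmaps : MapsTo (fun t => r * t + β) (Icc a b) (Icc (r * a + β) (r * b + β)) := by
    intro t ht
    constructor
    · have := mul_le_mul_of_nonneg_left ht.1 hr.le
      simpa using this
    · have := mul_le_mul_of_nonneg_left ht.2 hr.le
      simpa using this
  obtain ⟨K, hK⟩ := h q (r * a + β) (r * b + β) (by gcongr) (by gcongr) (by gcongr) (by
    rintro _ ⟨s, hs, rfl⟩
    refine hsub ⟨(s - β) / r, ⟨?_, ?_⟩, ?_⟩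
    · rw [le_div_iff₀ hr]; linarith [hs.1]
    · rw [div_le_iff₀ hr]; linarith [hs.2]
    · change x (r * ((s - β) / r) + β) = x s
      rw [mul_div_cancel₀ _ hr.ne', sub_add_cancel])
  have hl : LipschitzWith (Real.toNNReal r) fun t : ℝ => r * t + β := by
    refine LipschitzWith.of_dist_le_mul fun s t => ?_
    rw [Real.coe_toNNReal _ hr.le, Real.dist_eq, Real.dist_eq,
      show r * s + β - (r * t + β) = r * (s - t) by ring, abs_mul, abs_of_pos hr]
  exact ⟨_, hK.comp hl.lipschitzOnWith hmaps⟩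

/-- The Lipschitz condition survives concatenation with corners, and its bounded derivative is
square-integrable on a bounded interval. -/
theorem isH1Curve (h : LipschitzInCharts n x 0 1) (hx : ContinuousOn x (Icc 0 1)) :
    IsH1Curve n x := by
  refine ⟨hx, fun q a b h0 hab h1 hsub => ?_⟩
  obtain ⟨K, hK⟩ := h q a b h0 hab h1 hsub
  refine ⟨LipschitzOnWith.absolutelyContinuousOnInterval (K := K) (by rwa [uIcc_of_le hab]), ?_⟩
  rw [← restrict_Ioo_eq_restrict_Icc]
  refine MemLp.of_bound (aestronglyMeasurable_deriv _ _) K ?_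
  refine ae_restrict_of_forall_mem measurableSet_Ioo fun t ht => ?_
  exact norm_deriv_le_of_lipschitzOn (Icc_mem_nhds ht.1 ht.2) hK

theorem of_contMDiffAt [IsManifold (𝓡 n) ∞ M]
    (h : ∀ t ∈ Icc c d, ContMDiffAt 𝓘(ℝ, ℝ) (𝓡 n) ∞ x t) : LipschitzInCharts n x c d := by
  intro q a b hca hab hbd hsub
  refine ContDiffOn.exists_lipschitzOnWith (n := 1) (fun t ht => ?_) (by simp) (convex_Icc a b)
    isCompact_Icc
  have h1 : ContMDiffAt (𝓡 n) 𝓘(ℝ, EuclideanSpace ℝ (Fin n)) ∞ (extChartAt (𝓡 n) q) (x t) :=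
    contMDiffAt_extChartAt' (by simpa using hsub ⟨t, ht, rfl⟩)
  have h2 := h1.comp t (h t ⟨hca.trans ht.1, ht.2.trans hbd⟩)
  exact (h2.contDiffAt.of_le (by simp)).contDiffWithinAt

end LipschitzInCharts

theorem TangentBundle.mk_eq_mk {q q' : M} (h : q = q') (v : EuclideanSpace ℝ (Fin n)) :
    (⟨q, v⟩ : TangentBundle (𝓡 n) M) = ⟨q', v⟩ := by
  subst h
  rfl

variable {L : TangentBundle (𝓡 n) M → ℝ} {k : ℝ}

/-- Differentiability is not needed: the affine map is invertible, so both curves fail to be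
differentiable together, and then both velocities are 0. -/
theorem velocity_comp_affine (x : ℝ → M) {r : ℝ} (hr : r ≠ 0) (β t : ℝ) :
    velocity (n := n) (fun s => x (r * s + β)) t = (r • velocity (n := n) x (r * t + β) :) := by
  have haff : ∀ r β t : ℝ, HasMFDerivAt 𝓘(ℝ, ℝ) 𝓘(ℝ, ℝ) (fun s : ℝ => r * s + β) t
      (ContinuousLinearMap.toSpanSingleton ℝ r) := fun r β t => by
    have : HasDerivAt (fun s : ℝ => r * s + β) r t := by
      simpa using ((hasDerivAt_id t).const_mul r).add_const β
    exact this.hasFDerivAt.hasMFDerivAt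
  by_cases hx : MDifferentiableAt 𝓘(ℝ, ℝ) (𝓡 n) x (r * t + β)
  · have := (HasMFDerivAt.comp t hx.hasMFDerivAt (haff r β t)).mfderiv
    unfold velocity
    rw [show (fun s => x (r * s + β)) = x ∘ fun s => r * s + β from rfl, this]
    change (mfderiv 𝓘(ℝ, ℝ) (𝓡 n) x (r * t + β)) ((1 : ℝ) • r) = _
    have e : ((1 : ℝ) • r : ℝ) = r • (1 : ℝ) := by simp
    erw [e, map_smul]
  · have hx' : ¬ MDifferentiableAt 𝓘(ℝ, ℝ) (𝓡 n) (fun s => x (r * s + β)) t := by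
      intro h
      refine hx ?_
      have e : x = (fun s => x (r * s + β)) ∘ fun s => r⁻¹ * s + -(r⁻¹ * β) := by
        funext s
        simp only [Function.comp]
        congr 1
        field_simp
        ring
      have et : r⁻¹ * (r * t + β) + -(r⁻¹ * β) = t := by field_simp; ring
      rw [e]
      refine MDifferentiableAt.comp (r * t + β) ?_ (haff r⁻¹ _ _).mdifferentiableAt
      rw [et]
      exact h
    unfold velocity
    rw [mfderiv_zero_of_not_mdifferentiableAt hx, mfderiv_zero_of_not_mdifferentiableAt hx']
    change (0 : EuclideanSpace ℝ (Fin n)) = r • 0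
    simp

theorem actionIntegrand_one_congr {x x' : ℝ → M} {t : ℝ} (h : x =ᶠ[𝓝 t] x') :
    actionIntegrand L k x 1 t = actionIntegrand L k x' 1 t := by
  unfold actionIntegrand velocity
  rw [h.mfderiv_eq]
  exact congrArg (fun z => L z + k) (TangentBundle.mk_eq_mk h.self_of_nhds _)

theorem actionIntegrand_comp_affine (x : ℝ → M) {r : ℝ} (hr : r ≠ 0) (β t : ℝ) :
    actionIntegrand L k (fun s => x (r * s + β)) r t = actionIntegrand L k x 1 (r * t + β) := by
  unfold actionIntegrand
  rw [velocity_comp_affine x hr, smul_smul, inv_mul_cancel₀ hr, inv_one]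

theorem actionIntegrand_comp_add (x : ℝ → M) (β t : ℝ) :
    actionIntegrand L k (fun s => x (s + β)) 1 t = actionIntegrand L k x 1 (t + β) := by
  simpa using actionIntegrand_comp_affine (L := L) (k := k) x one_ne_zero β t

theorem actionIntegrand_comp_mul (x : ℝ → M) {T : ℝ} (hT : T ≠ 0) (t : ℝ) :
    actionIntegrand L k (fun s => x (T * s)) T t = actionIntegrand L k x 1 (T * t) := by
  simpa using actionIntegrand_comp_affine (L := L) (k := k) x hT 0 t

/-- The points `a` and `b` of `Q` are joined by a curve in `Q` whose image under `ι` has `k`-action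
at most `A`. -/
def JoinedWithAction {Q : Type*} [TopologicalSpace Q] (ι : Q → M) (L : TangentBundle (𝓡 n) M → ℝ)
    (k : ℝ) (a b : Q) (A : ℝ) : Prop :=
  ∃ T > 0, ∃ γ : ℝ → Q, γ 0 = a ∧ γ T = b ∧ ContinuousOn γ (Icc 0 T) ∧
    LipschitzInCharts n (ι ∘ γ) 0 T ∧
    IntervalIntegrable (actionIntegrand L k (ι ∘ γ) 1) volume 0 T ∧
    ∫ t in (0 : ℝ)..T, actionIntegrand L k (ι ∘ γ) 1 t ≤ A

/-- Curves run in real time on `[0, T]`, so durations and actions add without rescaling. -/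
theorem JoinedWithAction.trans {Q : Type*} [TopologicalSpace Q] {ι : Q → M} {a b c : Q} {A B : ℝ}
    (h₁ : JoinedWithAction ι L k a b A) (h₂ : JoinedWithAction ι L k b c B) :
    JoinedWithAction ι L k a c (A + B) := by
  obtain ⟨T₁, hT₁, γ₁, ha, hb, hc₁, hl₁, hi₁, hA⟩ := h₁
  obtain ⟨T₂, hT₂, γ₂, hb', hc, hc₂, hl₂, hi₂, hB⟩ := h₂
  set γ : ℝ → Q := fun t => if t ≤ T₁ then γ₁ t else γ₂ (t + -T₁)
  have e₁ : EqOn γ γ₁ (Icc 0 T₁) := fun t ht => if_pos ht.2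
  have e₂ : EqOn γ (fun t => γ₂ (t + -T₁)) (Icc T₁ (T₁ + T₂)) := by
    intro t ht
    rcases ht.1.eq_or_lt with rfl | hlt
    · simp [γ, hb, hb']
    · exact if_neg hlt.not_ge
  -- The velocity depends on the germ of the curve, so the integrands are compared on open
  -- intervals; the endpoints are negligible.
  have i₁ : EqOn (actionIntegrand L k (ι ∘ γ) 1) (actionIntegrand L k (ι ∘ γ₁) 1) (Ioo 0 T₁) := by
    intro t ht
    refine actionIntegrand_one_congr ?_
    filter_upwards [Ioo_mem_nhds ht.1 ht.2] with s hs
    simp [e₁ (Ioo_subset_Icc_self hs)]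
  have i₂ : EqOn (actionIntegrand L k (ι ∘ γ) 1)
      (fun t => actionIntegrand L k (ι ∘ γ₂) 1 (t - T₁)) (Ioo T₁ (T₁ + T₂)) := by
    intro t ht
    have := actionIntegrand_comp_add (L := L) (k := k) (ι ∘ γ₂) (-T₁) t
    rw [← sub_eq_add_neg] at this
    refine Eq.trans (actionIntegrand_one_congr ?_) this
    filter_upwards [Ioo_mem_nhds ht.1 ht.2] with s hs
    simp [e₂ (Ioo_subset_Icc_self hs)]
  have hT : T₁ ≤ T₁ + T₂ := by linarith
  have hshift : IntervalIntegrable (fun t => actionIntegrand L k (ι ∘ γ₂) 1 (t - T₁)) volume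
      T₁ (T₁ + T₂) := by
    have := hi₂.comp_sub_right T₁
    rwa [zero_add, add_comm T₂] at this
  have I₁ : IntervalIntegrable (actionIntegrand L k (ι ∘ γ) 1) volume 0 T₁ :=
    hi₁.congr_uIoo (by rw [uIoo_of_le hT₁.le]; exact i₁.symm)
  have I₂ : IntervalIntegrable (actionIntegrand L k (ι ∘ γ) 1) volume T₁ (T₁ + T₂) :=
    hshift.congr_uIoo (by rw [uIoo_of_le hT]; exact i₂.symm)
  refine ⟨T₁ + T₂, by linarith, γ, (e₁ ⟨le_rfl, hT₁.le⟩).trans ha, ?_, ?_, ?_, I₁.trans I₂, ?_⟩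
  · rw [e₂ ⟨hT, le_rfl⟩, ← hc]
    simp
  · rw [← Icc_union_Icc_eq_Icc hT₁.le hT]
    refine ContinuousOn.union_of_isClosed (hc₁.congr e₁) (ContinuousOn.congr ?_ e₂) isClosed_Icc
      isClosed_Icc
    refine hc₂.comp (by fun_prop) fun t ht => ⟨by linarith [ht.1], by linarith [ht.2]⟩
  · refine (hl₁.congr fun t ht => congrArg ι (e₁ ht)).union ?_
    refine LipschitzInCharts.congr ?_ fun t ht => congrArg ι (e₂ ht)
    have := LipschitzInCharts.comp_affine (n := n) (x := ι ∘ γ₂) (c := T₁) (d := T₁ + T₂) (β := -T₁)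
      one_pos (by convert! hl₂ using 1 <;> ring)
    simpa using this
  · rw [← intervalIntegral.integral_add_adjacent_intervals I₁ I₂,
      intervalIntegral.integral_congr_Ioo_of_le hT₁.le i₁,
      intervalIntegral.integral_congr_Ioo_of_le hT i₂,
      intervalIntegral.integral_comp_sub_right (fun t => actionIntegrand L k (ι ∘ γ₂) 1 t)]
    simp only [sub_self, add_sub_cancel_left]
    linarith

/-- A closed curve of negative action in `Q` excludes `k` from the energies above the Mañé critical
value of every cover to which `Q` lifts. -/
theorem JoinedWithAction.exists_loop_neg {m : M} {G : Subgroup (FundamentalGroup M m)} {Q : Type*}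
    [TopologicalSpace Q] {ι : Q → M} (hι : Continuous ι) {s : Q → CoverOf G} (hs : Continuous s)
    (hsι : ∀ x, coverProj G (s x) = ι x) {a : Q} {A : ℝ} (hA : A < 0)
    (h : JoinedWithAction ι L k a a A) :
    ∃ (y : ℝ → CoverOf G) (T : ℝ), IsH1LoopInCover n G y ∧ 0 < T ∧
      IntervalIntegrable (actionIntegrand L k (fun s => coverProj G (y s)) T) volume 0 1 ∧
      freeTimeAction L k (fun s => coverProj G (y s)) T < 0 := by
  obtain ⟨T, hT, γ, h0, h1, hc, hl, hi, hle⟩ := h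
  have hmaps : MapsTo (fun t : ℝ => T * t) (Icc 0 1) (Icc 0 T) := fun t ht =>
    ⟨mul_nonneg hT.le ht.1, mul_le_of_le_one_right hT.le ht.2⟩
  have hγ : ContinuousOn (fun t => γ (T * t)) (Icc 0 1) := hc.comp (by fun_prop) hmaps
  have e : (fun t => coverProj G (s (γ (T * t)))) = fun t => (ι ∘ γ) (T * t) := by
    funext t
    exact hsι _
  -- On the unit interval the factor `T` of the velocity cancels `T⁻¹`; the outer `T` of the action
  -- is the Jacobian.
  have eI : actionIntegrand L k (fun t => (ι ∘ γ) (T * t)) T =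
      fun t => actionIntegrand L k (ι ∘ γ) 1 (T * t) :=
    funext fun t => actionIntegrand_comp_mul (ι ∘ γ) hT.ne' t
  refine ⟨fun t => s (γ (T * t)), T, ⟨hs.comp_continuousOn hγ, by simp [h0, h1], ?_⟩, hT, ?_, ?_⟩
  · rw [e]
    refine LipschitzInCharts.isH1Curve ?_ (hι.comp_continuousOn hγ)
    have := LipschitzInCharts.comp_affine (n := n) (x := ι ∘ γ) (c := 0) (d := 1) (β := 0)
      hT (by simpa using hl)
    simpa using this
  · rw [e, eI]
    have := hi.comp_mul_left (c := T)
    rwa [zero_div, div_self hT.ne'] at this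
  · rw [e]
    unfold freeTimeAction
    rw [eI, ← smul_eq_mul, intervalIntegral.smul_integral_comp_mul_left]
    simp only [mul_zero, mul_one]
    linarith

end Curves

/-! ### A closed curve of negative action by recurrence -/

section Recurrence

variable {n : ℕ} {M : Type*} [TopologicalSpace M] [ChartedSpace (EuclideanSpace ℝ (Fin n)) M]
  {d : ℕ} {Q : Type*} [TopologicalSpace Q] [ChartedSpace (EuclideanSpace ℝ (Fin d)) Q]
  [IsManifold (𝓡 d) ∞ Q] {ι : Q → M}

theorem contMDiffOn_comp_extChartAt_symm (hι : ContMDiff (𝓡 d) (𝓡 n) ∞ ι) (x : Q) :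
    ContMDiffOn 𝓘(ℝ, EuclideanSpace ℝ (Fin d)) (𝓡 n) ∞ (ι ∘ (extChartAt (𝓡 d) x).symm)
      (extChartAt (𝓡 d) x).target :=
  hι.comp_contMDiffOn (contMDiffOn_extChartAt_symm x)

variable [IsManifold (𝓡 n) ∞ M] {L : TangentBundle (𝓡 n) M → ℝ} {k : ℝ}

theorem joinedWithAction_line (hL : Continuous L) (hι : ContMDiff (𝓡 d) (𝓡 n) ∞ ι) (x : Q)
    {w v : EuclideanSpace ℝ (Fin d)} {τ B : ℝ} (hτ : 0 < τ)
    (hmem : ∀ t ∈ Icc 0 τ, w + t • v ∈ (extChartAt (𝓡 d) x).target)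
    (hB : ∀ t ∈ Icc 0 τ, L ⟨(ι ∘ (extChartAt (𝓡 d) x).symm) (w + t • v),
      mfderiv 𝓘(ℝ, EuclideanSpace ℝ (Fin d)) (𝓡 n) (ι ∘ (extChartAt (𝓡 d) x).symm) (w + t • v) v⟩
        + k ≤ B) :
    JoinedWithAction ι L k ((extChartAt (𝓡 d) x).symm w)
      ((extChartAt (𝓡 d) x).symm (w + τ • v)) (τ * B) := by
  set φ := extChartAt (𝓡 d) x
  have hU : IsOpen φ.target := isOpen_extChartAt_target x
  have hf : ContMDiffOn 𝓘(ℝ, EuclideanSpace ℝ (Fin d)) (𝓡 n) ∞ (ι ∘ φ.symm) φ.target :=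
    contMDiffOn_comp_extChartAt_symm hι x
  set f := ι ∘ φ.symm
  have hline : ∀ t : ℝ, HasMFDerivAt 𝓘(ℝ, ℝ) 𝓘(ℝ, EuclideanSpace ℝ (Fin d))
      (fun t : ℝ => w + t • v) t (ContinuousLinearMap.toSpanSingleton ℝ v) := by
    intro t
    have : HasDerivAt (fun t : ℝ => w + t • v) v t := by
      simpa using ((hasDerivAt_id t).smul_const v).const_add w
    exact this.hasFDerivAt.hasMFDerivAt
  have hsm : ∀ t ∈ Icc 0 τ, ContMDiffAt 𝓘(ℝ, EuclideanSpace ℝ (Fin d)) (𝓡 n) ∞ f (w + t • v) :=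
    fun t ht => hf.contMDiffAt (hU.mem_nhds (hmem t ht))
  have hlinesm : ContMDiff 𝓘(ℝ, ℝ) 𝓘(ℝ, EuclideanSpace ℝ (Fin d)) ∞ fun t : ℝ => w + t • v :=
    ContDiff.contMDiff (by fun_prop)
  have eI : EqOn (actionIntegrand L k (ι ∘ fun t => φ.symm (w + t • v)) 1)
      (fun t => L ⟨f (w + t • v),
        mfderiv 𝓘(ℝ, EuclideanSpace ℝ (Fin d)) (𝓡 n) f (w + t • v) v⟩ + k) (Icc 0 τ) := by
    intro t ht
    have h1 := (HasMFDerivAt.comp t ((hsm t ht).mdifferentiableAt (by simp)).hasMFDerivAt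
      (hline t)).mfderiv
    change L ⟨f (w + t • v), (1 : ℝ)⁻¹ • (mfderiv 𝓘(ℝ, ℝ) (𝓡 n) (f ∘ fun t : ℝ => w + t • v) t) (1 : ℝ)⟩
      + k = _
    rw [h1, inv_one, one_smul]
    change L ⟨f (w + t • v), mfderiv 𝓘(ℝ, EuclideanSpace ℝ (Fin d)) (𝓡 n) f (w + t • v)
      ((1 : ℝ) • v)⟩ + k = _
    rw [one_smul]
  have hcI : ContinuousOn (fun t => L ⟨f (w + t • v),
      mfderiv 𝓘(ℝ, EuclideanSpace ℝ (Fin d)) (𝓡 n) f (w + t • v) v⟩ + k) (Icc 0 τ) :=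
    ((continuousOn_lagrangian_mfderiv hL hU hf).comp
      (by fun_prop : ContinuousOn (fun t : ℝ => (w + t • v, v)) (Icc 0 τ))
      fun t ht => ⟨hmem t ht, mem_univ _⟩).add continuousOn_const
  have hint : IntervalIntegrable (actionIntegrand L k (ι ∘ fun t => φ.symm (w + t • v)) 1)
      volume 0 τ := by
    refine (hcI.congr eI).intervalIntegrable_of_Icc hτ.le
  refine ⟨τ, hτ, fun t => φ.symm (w + t • v), by simp, rfl, ?_, ?_, hint, ?_⟩
  · exact (continuousOn_extChartAt_symm x).comp (by fun_prop) hmem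
  · exact LipschitzInCharts.of_contMDiffAt fun t ht => ContMDiffAt.comp (g := f) t (hsm t ht) hlinesm.contMDiffAt
  · calc _ ≤ ∫ t in (0 : ℝ)..τ, B := intervalIntegral.integral_mono_on hτ.le hint
          (intervalIntegrable_const) fun t ht => (eI ht).trans_le (hB t ht)
      _ = τ * B := by simp

/-- Negativity of `L + k` is an open condition: it persists near `x` for a fixed chart velocity, so
chart segments of a common duration lose a definite amount. -/
theorem exists_nhds_joinedWithAction_neg (hL : Continuous L) (hι : ContMDiff (𝓡 d) (𝓡 n) ∞ ι)
    (x : Q) (hx : ∃ w : TangentSpace (𝓡 d) x, L ⟨ι x, mfderiv (𝓡 d) (𝓡 n) ι x w⟩ + k < 0) :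
    ∃ V ∈ 𝓝 x, ∃ α > 0, ∀ a ∈ V, ∃ b, JoinedWithAction ι L k a b (-α) := by
  set φ := extChartAt (𝓡 d) x
  have hU : IsOpen φ.target := isOpen_extChartAt_target x
  have hf : ContMDiffOn 𝓘(ℝ, EuclideanSpace ℝ (Fin d)) (𝓡 n) ∞ (ι ∘ φ.symm) φ.target :=
    contMDiffOn_comp_extChartAt_symm hι x
  have hw₀ : φ x ∈ φ.target := mem_extChartAt_target x
  obtain ⟨v, hv⟩ : ∃ v : EuclideanSpace ℝ (Fin d), L ⟨(ι ∘ φ.symm) (φ x),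
      mfderiv 𝓘(ℝ, EuclideanSpace ℝ (Fin d)) (𝓡 n) (ι ∘ φ.symm) (φ x) v⟩ + k < 0 := by
    obtain ⟨w, hw⟩ := hx
    refine ⟨mfderiv (𝓡 d) 𝓘(ℝ, EuclideanSpace ℝ (Fin d)) φ x w, ?_⟩
    have hφ : MDifferentiableAt (𝓡 d) 𝓘(ℝ, EuclideanSpace ℝ (Fin d)) φ x :=
      mdifferentiableAt_extChartAt (mem_chart_source _ x)
    have hg : MDifferentiableAt 𝓘(ℝ, EuclideanSpace ℝ (Fin d)) (𝓡 n) (ι ∘ φ.symm) (φ x) :=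
      (hf.contMDiffAt (hU.mem_nhds hw₀)).mdifferentiableAt (by simp)
    have h1 := mfderiv_comp x hg hφ
    have h2 : (ι ∘ φ.symm) ∘ φ =ᶠ[𝓝 x] ι := by
      filter_upwards [show φ.source ∈ 𝓝 x from extChartAt_source_mem_nhds x] with y hy
      simp [φ.left_inv hy]
    rw [h2.mfderiv_eq] at h1
    have h3 : mfderiv 𝓘(ℝ, EuclideanSpace ℝ (Fin d)) (𝓡 n) (ι ∘ φ.symm) (φ x)
      (mfderiv (𝓡 d) 𝓘(ℝ, EuclideanSpace ℝ (Fin d)) φ x w) = mfderiv (𝓡 d) (𝓡 n) ι x w := by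
      exact (DFunLike.congr_fun h1 w).symm
    rw [h3]
    refine lt_of_eq_of_lt ?_ hw
    exact congrArg (fun z => L z + k) (TangentBundle.mk_eq_mk h2.self_of_nhds _)
  have hc : ContinuousAt (fun z => L ⟨(ι ∘ φ.symm) z,
      mfderiv 𝓘(ℝ, EuclideanSpace ℝ (Fin d)) (𝓡 n) (ι ∘ φ.symm) z v⟩ + k) (φ x) := by
    have h1 := (continuousOn_lagrangian_mfderiv hL hU hf).continuousAt
      ((hU.prod isOpen_univ).mem_nhds (show (φ x, v) ∈ φ.target ×ˢ univ from ⟨hw₀, mem_univ _⟩))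
    exact (ContinuousAt.comp (f := fun z : EuclideanSpace ℝ (Fin d) => (z, v)) h1
      (by fun_prop)).add continuousAt_const
  obtain ⟨B, hB, hB0⟩ := exists_between hv
  have hev : ∀ᶠ z in 𝓝 (φ x), z ∈ φ.target ∧ L ⟨(ι ∘ φ.symm) z,
      mfderiv 𝓘(ℝ, EuclideanSpace ℝ (Fin d)) (𝓡 n) (ι ∘ φ.symm) z v⟩ + k < B :=
    Filter.Eventually.and (hU.mem_nhds hw₀) (hc.eventually_lt_const hB)
  obtain ⟨r, hr, hball⟩ := Metric.eventually_nhds_iff.1 hev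
  -- Segments starting within `r / 2` of the centre stay in the ball of radius `r`; the `+ 1` covers
  -- `v = 0`.
  set τ := r / 2 / (‖v‖ + 1)
  have hτ : 0 < τ := by positivity
  refine ⟨φ.source ∩ φ ⁻¹' Metric.ball (φ x) (r / 2),
    Filter.inter_mem (extChartAt_source_mem_nhds x)
      (continuousAt_extChartAt x (Metric.ball_mem_nhds _ (by positivity))), τ * -B,
    mul_pos hτ (by linarith), fun a ha => ?_⟩
  have hnear : ∀ t ∈ Icc 0 τ, dist (φ a + t • v) (φ x) < r := by
    intro t ht
    have h1 : dist (φ a) (φ x) < r / 2 := ha.2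
    have h2 : ‖t • v‖ ≤ r / 2 := by
      rw [norm_smul, Real.norm_of_nonneg ht.1]
      calc t * ‖v‖ ≤ τ * (‖v‖ + 1) := by
            gcongr
            · exact ht.2
            · linarith
        _ = r / 2 := div_mul_cancel₀ _ (by positivity)
    rw [dist_eq_norm] at h1 ⊢
    calc ‖φ a + t • v - φ x‖ = ‖(φ a - φ x) + t • v‖ := by congr 1; abel
      _ ≤ ‖φ a - φ x‖ + ‖t • v‖ := norm_add_le _ _
      _ < r := by linarith
  have := joinedWithAction_line (k := k) (B := B) hL hι x hτ (fun t ht => (hball (hnear t ht)).1)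
    fun t ht => (hball (hnear t ht)).2.le
  rw [φ.left_inv ha.1] at this
  exact ⟨_, by simpa using this⟩

/-- This bounds the cost of closing up. Unit-time chart segments between nearby points have
positions and velocities in a compact set, where `L` is bounded above. -/
theorem exists_nhds_joinedWithAction_le (hL : Continuous L) (hι : ContMDiff (𝓡 d) (𝓡 n) ∞ ι)
    (k : ℝ) (x : Q) :
    ∃ V ∈ 𝓝 x, ∃ C, ∀ a ∈ V, ∀ b ∈ V, JoinedWithAction ι L k a b C := by
  set φ := extChartAt (𝓡 d) x
  have hU : IsOpen φ.target := isOpen_extChartAt_target x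
  have hf : ContMDiffOn 𝓘(ℝ, EuclideanSpace ℝ (Fin d)) (𝓡 n) ∞ (ι ∘ φ.symm) φ.target :=
    contMDiffOn_comp_extChartAt_symm hι x
  have hw₀ : φ x ∈ φ.target := mem_extChartAt_target x
  obtain ⟨r, hr, hball⟩ := Metric.nhds_basis_closedBall.mem_iff.1 (hU.mem_nhds hw₀)
  have hK : IsCompact (Metric.closedBall (φ x) r ×ˢ
      Metric.closedBall (0 : EuclideanSpace ℝ (Fin d)) (2 * r)) :=
    (isCompact_closedBall _ _).prod (isCompact_closedBall _ _)
  obtain ⟨C, hC⟩ := (hK.image_of_continuousOn ((continuousOn_lagrangian_mfderiv hL hU hf).mono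
    (prod_mono hball (subset_univ _)))).bddAbove
  refine ⟨φ.source ∩ φ ⁻¹' Metric.ball (φ x) r,
    Filter.inter_mem (extChartAt_source_mem_nhds x)
      (continuousAt_extChartAt x (Metric.ball_mem_nhds _ hr)), 1 * (C + k), fun a ha b hb => ?_⟩
  have ha' : φ a ∈ Metric.closedBall (φ x) r := Metric.ball_subset_closedBall ha.2
  have hb' : φ b ∈ Metric.closedBall (φ x) r := Metric.ball_subset_closedBall hb.2
  have hseg : ∀ t ∈ Icc (0 : ℝ) 1, φ a + t • (φ b - φ a) ∈ Metric.closedBall (φ x) r :=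
    fun t ht => (convex_closedBall (φ x) r).add_smul_sub_mem ha' hb' ht
  have hv : φ b - φ a ∈ Metric.closedBall (0 : EuclideanSpace ℝ (Fin d)) (2 * r) := by
    rw [mem_closedBall_zero_iff, ← dist_eq_norm]
    linarith [dist_triangle_right (φ b) (φ a) (φ x), Metric.mem_closedBall.1 ha',
      Metric.mem_closedBall.1 hb']
  have := joinedWithAction_line (k := k) (B := C + k) hL hι x one_pos
    (fun t ht => hball (hseg t ht)) fun t ht => by
      have := hC ⟨(φ a + t • (φ b - φ a), φ b - φ a), ⟨hseg t ht, hv⟩, rfl⟩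
      exact add_le_add_left this k
  rwa [one_smul, add_sub_cancel, φ.left_inv ha.1, φ.left_inv hb.1] at this

/-- If every point of the compact manifold `Q` has a tangent vector of negative `L + k`, then there
is a closed curve in `Q` of negative `k`-action. -/
theorem exists_joinedWithAction_self_neg [CompactSpace Q] [Nonempty Q] (hL : Continuous L)
    (hι : ContMDiff (𝓡 d) (𝓡 n) ∞ ι)
    (h : ∀ x : Q, ∃ w : TangentSpace (𝓡 d) x, L ⟨ι x, mfderiv (𝓡 d) (𝓡 n) ι x w⟩ + k < 0) :
    ∃ a : Q, ∃ A < 0, JoinedWithAction ι L k a a A := by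
  obtain ⟨α, hα, step⟩ : ∃ α > 0, ∀ a : Q, ∃ b, ∃ A ≤ -α, JoinedWithAction ι L k a b A := by
    choose V hV α hα hstep using fun x => exists_nhds_joinedWithAction_neg hL hι x (h x)
    obtain ⟨t, ht⟩ := isCompact_univ.elim_nhds_subcover V fun x _ => hV x
    have hne : t.Nonempty := by
      obtain ⟨x⟩ := ‹Nonempty Q›
      obtain ⟨y, hy, -⟩ := mem_iUnion₂.1 (ht.2 (mem_univ x))
      exact ⟨y, hy⟩
    refine ⟨t.inf' hne α, (Finset.lt_inf'_iff _).2 fun x _ => hα x, fun a => ?_⟩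
    obtain ⟨x, hx, hax⟩ := mem_iUnion₂.1 (ht.2 (mem_univ a))
    obtain ⟨b, hb⟩ := hstep x a hax
    exact ⟨b, _, neg_le_neg (Finset.inf'_le α hx), hb⟩
  choose next A hA hnext using step
  obtain ⟨x₀⟩ := ‹Nonempty Q›
  set orbit : ℕ → Q := fun i => next^[i] x₀
  -- The count starts at one step, since a joining curve must have positive duration.
  have hsteps : ∀ i j : ℕ, ∃ A ≤ -((j + 1 : ℕ) * α),
      JoinedWithAction ι L k (orbit i) (orbit (i + (j + 1))) A := by
    intro i j
    induction j with
    | zero =>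
      refine ⟨_, by simpa using hA (orbit i), ?_⟩
      have := hnext (orbit i)
      rwa [← Function.iterate_succ_apply' next] at this
    | succ j ih =>
      obtain ⟨A', hA', hj⟩ := ih
      refine ⟨A' + A (orbit (i + (j + 1))), ?_, ?_⟩
      · have := hA (orbit (i + (j + 1)))
        push_cast at hA' ⊢
        linarith
      · have := hj.trans (hnext (orbit (i + (j + 1))))
        rwa [← Function.iterate_succ_apply' next] at this
  obtain ⟨z, -, hz⟩ := isCompact_univ.exists_mapClusterPt (f := Filter.atTop) (u := orbit)
    (by simp)
  obtain ⟨W, hW, C, hC⟩ := exists_nhds_joinedWithAction_le hL hι k z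
  have hfreq := hz.frequently hW
  obtain ⟨i, hi⟩ := hfreq.exists
  -- A return to `W` after more than `N` steps has lost more than `C`, the most that closing up can
  -- cost.
  obtain ⟨N, hN⟩ := exists_nat_gt (C / α)
  obtain ⟨j, hij, hj⟩ := Filter.frequently_atTop.1 hfreq (i + (N + 1))
  obtain ⟨l, rfl⟩ := Nat.exists_eq_add_of_le hij
  obtain ⟨A', hA', hJ⟩ := hsteps i (N + l)
  refine ⟨orbit i, A' + C, ?_, hJ.trans (hC _ ?_ _ hi)⟩
  · rw [div_lt_iff₀ hα] at hN
    have : (0 : ℝ) ≤ (l + 1) * α := by positivity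
    push_cast at hA'
    linarith
  · rwa [show i + (N + l + 1) = i + (N + 1) + l by ring]

end Recurrence

/-- The energy levels in the definition of the Mañé critical value of `M̃ / G` bound from above the
Hamiltonian at some point of the conormal bundle of every compact submanifold that lifts to
`M̃ / G`. -/
theorem IsTonelli.exists_conormal_hamiltonian_le {n : ℕ} {M : Type*} [TopologicalSpace M]
    [ChartedSpace (EuclideanSpace ℝ (Fin n)) M] [IsManifold (𝓡 n) ∞ M]
    {g : ContMDiffRiemannianMetric (𝓡 n) ∞ (EuclideanSpace ℝ (Fin n))
      (fun q : M => TangentSpace (𝓡 n) q)} {L : TangentBundle (𝓡 n) M → ℝ} (hL : IsTonelli g L)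
    {d : ℕ} {Q : Type*} [TopologicalSpace Q] [ChartedSpace (EuclideanSpace ℝ (Fin d)) Q]
    [IsManifold (𝓡 d) ∞ Q] [CompactSpace Q] [Nonempty Q] {ι : Q → M}
    (hι : ContMDiff (𝓡 d) (𝓡 n) ∞ ι) {m : M} {G : Subgroup (FundamentalGroup M m)}
    {s : Q → CoverOf G} (hs : Continuous s) (hsι : ∀ x, coverProj G (s x) = ι x) {k : ℝ}
    (hk : ∀ (y : ℝ → CoverOf G) (T : ℝ), IsH1LoopInCover n G y → 0 < T →
      IntervalIntegrable (actionIntegrand L k (fun s => coverProj G (y s)) T) volume 0 1 →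
      0 ≤ freeTimeAction L k (fun s => coverProj G (y s)) T) :
    ∃ ξ ∈ conormalBundle (n := n) (d := d) ι, hamiltonian L ξ ≤ k := by
  by_contra! hcon
  obtain ⟨a, A, hA, hJ⟩ := exists_joinedWithAction_self_neg (k := k) hL.smooth.continuous hι
    fun x => by
      by_contra! hx
      -- If `L + k ≥ 0` on the tangent space of `Q` at `x`, duality yields a conormal covector of
      -- energy at most `k`, which was excluded.
      obtain ⟨p, hp, hle⟩ := hL.exists_hamiltonian_le (ι x) k
        (mfderiv (𝓡 d) (𝓡 n) ι x).toLinearMap.range (by rintro _ ⟨w, rfl⟩; exact hx w)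
      exact (hcon ⟨ι x, p⟩ ⟨x, p, rfl, fun w => hp _ ⟨w, rfl⟩⟩).not_ge hle
  obtain ⟨y, T, hy, hT, hi, hneg⟩ := hJ.exists_loop_neg hι.continuous hs hsι hA
  exact (hk y T hy hT hi).not_gt hneg

end

theorem mainTheorem9 {n d₀ d₁ : ℕ}
    {M : Type*} [TopologicalSpace M] [ChartedSpace (EuclideanSpace ℝ (Fin n)) M]
    [IsManifold (𝓡 n) ∞ M] [T2Space M] [CompactSpace M] [ConnectedSpace M]
    (g : ContMDiffRiemannianMetric (𝓡 n) ∞ (EuclideanSpace ℝ (Fin n))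
      (fun q : M => TangentSpace (𝓡 n) q))
    (L : TangentBundle (𝓡 n) M → ℝ) (hL : IsTonelli g L)
    {Q₀ : Type*} [TopologicalSpace Q₀] [ChartedSpace (EuclideanSpace ℝ (Fin d₀)) Q₀]
    [IsManifold (𝓡 d₀) ∞ Q₀] [CompactSpace Q₀] [ConnectedSpace Q₀]
    {Q₁ : Type*} [TopologicalSpace Q₁] [ChartedSpace (EuclideanSpace ℝ (Fin d₁)) Q₁]
    [IsManifold (𝓡 d₁) ∞ Q₁] [CompactSpace Q₁] [ConnectedSpace Q₁]
    (ι₀ : Q₀ → M) (hι₀ : IsSmoothEmbedding (𝓡 d₀) (𝓡 n) ∞ ι₀)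
    (ι₁ : Q₁ → M) (hι₁ : IsSmoothEmbedding (𝓡 d₁) (𝓡 n) ∞ ι₁)
    (m : M) (G₀ G₁ : Subgroup (FundamentalGroup M m))
    (hG₀ : G₀ = normalImage ι₀ hι₀.isEmbedding.continuous m)
    (hG₁ : G₁ = normalImage ι₁ hι₁.isEmbedding.continuous m) :
    energyThreshold (d₀ := d₀) (d₁ := d₁) L ι₀ ι₁ ≤ maneValue L (G₀ ⊔ G₁) ∧
    energyThreshold (d₀ := d₀) (d₁ := d₁) L ι₀ ι₁ ≤ maneValueHam L (G₀ ⊔ G₁) ∧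
    energyThreshold (d₀ := d₀) (d₁ := d₁) L ι₀ ι₁ ≤ max (maneValue L G₀) (maneValue L G₁) := by
  have : LocallyPathConnectedSpace M :=
    ChartedSpace.locallyPathConnectedSpace (EuclideanSpace ℝ (Fin n)) M
  have : LocallyPathConnectedSpace Q₀ :=
    ChartedSpace.locallyPathConnectedSpace (EuclideanSpace ℝ (Fin d₀)) Q₀
  have : LocallyPathConnectedSpace Q₁ :=
    ChartedSpace.locallyPathConnectedSpace (EuclideanSpace ℝ (Fin d₁)) Q₁
  have : PathConnectedSpace M := .of_locallyPathConnectedSpace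
  have : PathConnectedSpace Q₀ := .of_locallyPathConnectedSpace
  have : PathConnectedSpace Q₁ := .of_locallyPathConnectedSpace
  have hi₀ := hι₀.isImmersion
  have hi₁ := hι₁.isImmersion
  obtain ⟨s₀, hs₀, hsι₀⟩ := exists_lift_cover (d := d₀) hι₀.isEmbedding.continuous hG₀.ge
  obtain ⟨s₁, hs₁, hsι₁⟩ := exists_lift_cover (d := d₁) hι₁.isEmbedding.continuous hG₁.ge
  obtain ⟨r₀, hr₀, hrι₀⟩ := exists_lift_cover (d := d₀) hι₀.isEmbedding.continuous
    (hG₀.ge.trans (le_sup_left : G₀ ≤ G₀ ⊔ G₁))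
  obtain ⟨r₁, hr₁, hrι₁⟩ := exists_lift_cover (d := d₁) hι₁.isEmbedding.continuous
    (hG₁.ge.trans (le_sup_right : G₁ ≤ G₀ ⊔ G₁))
  refine ⟨le_sInf ?_, le_sInf ?_, le_of_forall_gt fun e he => ?_⟩
  · rintro _ ⟨k, hk, rfl⟩
    obtain ⟨ξ₀, h₀, hle₀⟩ := hL.exists_conormal_hamiltonian_le hi₀.contMDiff hr₀ hrι₀ hk
    obtain ⟨ξ₁, h₁, hle₁⟩ := hL.exists_conormal_hamiltonian_le hi₁.contMDiff hr₁ hrι₁ hk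
    exact hL.energyThreshold_le hi₀ hi₁ h₀ h₁ (EReal.coe_le_coe_iff.2 hle₀)
      (EReal.coe_le_coe_iff.2 hle₁)
  · rintro _ ⟨u, η, hu, rfl⟩
    obtain ⟨z₀, h₀⟩ := exists_conormal_of_hasSmoothGermAt hi₀.contMDiff hr₀ hrι₀ hu
    obtain ⟨z₁, h₁⟩ := exists_conormal_of_hasSmoothGermAt hi₁.contMDiff hr₁ hrι₁ hu
    exact hL.energyThreshold_le hi₀ hi₁ h₀ h₁
      (le_iSup (fun z => ((hamiltonian L ⟨coverProj _ z, η z⟩ : ℝ) : EReal)) z₀)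
      (le_iSup (fun z => ((hamiltonian L ⟨coverProj _ z, η z⟩ : ℝ) : EReal)) z₁)
  -- Each submanifold uses its own cover and its own admissible level; only the larger of the two
  -- levels matters when the energies are matched.
  · obtain ⟨he₀, he₁⟩ := max_lt_iff.1 he
    obtain ⟨_, ⟨k₀, hk₀, rfl⟩, hlt₀⟩ := sInf_lt_iff.1 he₀
    obtain ⟨_, ⟨k₁, hk₁, rfl⟩, hlt₁⟩ := sInf_lt_iff.1 he₁
    obtain ⟨ξ₀, h₀, hle₀⟩ := hL.exists_conormal_hamiltonian_le hi₀.contMDiff hs₀ hsι₀ hk₀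
    obtain ⟨ξ₁, h₁, hle₁⟩ := hL.exists_conormal_hamiltonian_le hi₁.contMDiff hs₁ hsι₁ hk₁
    refine (hL.energyThreshold_le hi₀ hi₁ h₀ h₁ ?_ ?_).trans_lt (max_lt hlt₀ hlt₁)
    · exact (EReal.coe_le_coe_iff.2 hle₀).trans (le_max_left _ _)
    · exact (EReal.coe_le_coe_iff.2 hle₁).trans (le_max_right _ _)
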